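/- **Setting.** Consider a two-player zero-sum Markov game with finite state space $\mathcal S$, finite action sets $\mathcal A_1,\mathcal A_2$, horizon $T$, initial distribution $P_I$, transition probabilities $P_T(s'\mid s,a^1,a^2)$, reward distributions $P_R(\cdot\mid s,a^1,a^2)$ on $\mathbb R$ with mean $R(s,a^1,a^2)$, and discount factor $\gamma\in[0,1]$. Player 1 receives $r_t$ and player 2 receives $-r_t$. For a profile $\pi=(\pi_1,\pi_2)$ of Markov policies $\pi_i=(\pi_{i,t})_{1\le t\le T}$ write $\pi_t(a^1,a^2\mid s)=\pi_{1,t}(a^1\mid s)\pi_{2,t}(a^2\mid s)$, let $v_1(\pi)=\mathbb E_\pi[\sum_{t=1}^T\gamma^{t-1}r_t]$ and $v_2=-v_1$, let $V_t$ and $Q_t$ be the state and state-action value functions of player 1 under $\pi$ at step $t$ (with $V_{T+1}=0$), and let $p^\pi_t(s,a^1,a^2)$ be the marginal state-action distribution at step $t$. Fix a behavior profile $\pi^b$ and policy classes $\Pi_1,\Pi_2$, put $\Pi=\Pi_1\times\Pi_2$, and let $\pi^e\in\Pi$. Put $\mu_t=p^\pi_t/p^{\pi^b}_t$, $\mu_0=1$,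 and $$v^{\exp}_\Pi(\pi^e)=\max_{\pi_1\in\Pi_1}v_1(\pi_1,\pi^e_2)+\max_{\pi_2\in\Pi_2}v_2(\pi^e_1,\pi_2).$$ **Estimator.** The data $\mathcal D$ are $n$ independent trajectories $(s_{i,1},a^1_{i,1},a^2_{i,1},r_{i,1},\dots,s_{i,T},a^1_{i,T},a^2_{i,T},r_{i,T},s_{i,T+1})$ drawn under $\pi^b$, split into $K$ evenly sized folds; $k(i)$ is the fold of $i$. For each fold $k$, estimates $\hat P_I^{-k},\hat P_T^{-k},\hat R^{-k},\hat p_{b,t}^{-k}$ of $P_I,P_T,R,p^{\pi^b}_t$ are computed from the data outside fold $k$. For each $\pi$, let $\hat Q^{-k}_t$ be the state-action value function of $\pi$ in the model $(\hat R^{-k},\hat P_T^{-k})$, let $\hat V^{-k}_t(s)=\sum_{a^1,a^2}\pi_t(a^1,a^2\mid s)\hat Q^{-k}_t(s,a^1,a^2)$, and let $\hat\mu^{-k}_t$ be the marginal state-action density of $\pi$ in the model $(\hat P_I^{-k},\hat P_T^{-k})$ divided by $\hat p_{b,t}^{-k}$, with $\hat\mu_0^{-k}=1$. Put $$\hat v_1(\pi)=\frac1n\sum_{i=1}^n\sum_{t=1}^T\gamma^{t-1}\Big(\hat\mu^{-k(i)}_t\big(r_{i,t}-\hat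 Q^{-k(i)}_t\big)+\hat\mu^{-k(i)}_{t-1}\hat V^{-k(i)}_t\Big),\qquad \hat v_2=-\hat v_1,$$ where the functions are evaluated along the $i$-th trajectory, and $$\hat v^{\exp}_{\mathrm{DRL}}(\pi^e)=\max_{\pi_1\in\Pi_1}\hat v_1(\pi_1,\pi_2^e)+\max_{\pi_2\in\Pi_2}\hat v_2(\pi_1^e,\pi_2).$$ **Complexity.** For $m\ge1$ state trajectories $(s_{i,1},\dots,s_{i,T})_{i\le m}$, the Hamming distance of two profiles is the fraction of indices $i$ for which, for some $t$ and some player $j$, the two action distributions $\pi_{j,t}(\cdot\mid s_{i,t})$ differ. $N_H(\epsilon,\Pi)$ is the supremum, over all $m\ge1$ and all families of $m$ state trajectories, of the least number of profiles in $\Pi$ that $\epsilon$-cover $\Pi$ in this distance, and $\kappa(\Pi)=\int_0^\infty\sqrt{\log N_H(\epsilon^2,\Pi)}\,d\epsilon$. **Theorem.** Assume the following. 1. For some $C_0$ and $R_{\max}$, $\pi_t(a^1,a^2\mid s)\le C_0\,\pi^b_t(a^1,a^2\mid s)$ for all $\pi\in\Pi$, $t$, $s$, $a^1$, $a^2$,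 and all rewards satisfy $|r|\le R_{\max}$ almost surely. 2. Almost surely, for every $\pi\in\Pi$, $0\le\hat\mu^{-k}_t\le C_0^t$ and $|\hat Q^{-k}_t|\le(T+1-t)R_{\max}$ at every $(s,a^1,a^2)$ with $p^{\pi^b}_t(s,a^1,a^2)>0$, $1\le t\le T$. 3. There are $D_1,D_2>0$ and $0\le\omega<\frac12$ such that $N_H(\epsilon,\Pi)\le D_1\exp(D_2\epsilon^{-\omega})$ for $0<\epsilon<1$. 4. There are $\alpha_1,\alpha_2>0$ with $\alpha_1+\alpha_2\ge\frac12$ such that, for every fold $k$, with expectations over the data: (a) for $1\le t\le t'\le T$ and every sequence $(s_l,a^1_l,a^2_l)_{t\le l\le t'}$ with $p^{\pi^b}_t(s_t,a^1_t,a^2_t)>0$ and $\pi^b_l(a^1_l,a^2_l\mid s_l)>0$ for $t<l\le t'$, $$\mathbb E\Big[\Big(\hat R^{-k}(s_{t'},a^1_{t'},a^2_{t'})\prod_{l=t}^{t'-1}\hat P_T^{-k}(s_{l+1}\mid s_l,a^1_l,a^2_l)-R(s_{t'},a^1_{t'},a^2_{t'})\prod_{l=t}^{t'-1}P_T(s_{l+1}\mid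 s_l,a^1_l,a^2_l)\Big)^2\Big]=o(n^{-2\alpha_1});$$ (b) for $1\le t\le T$ and every sequence $(s_l,a^1_l,a^2_l)_{1\le l\le t}$ with $p^{\pi^b}_t(s_t,a^1_t,a^2_t)>0$ and $\pi^b_l(a^1_l,a^2_l\mid s_l)>0$ for $l<t$, $$\mathbb E\Big[\Big(\frac{\hat P_I^{-k}(s_1)\prod_{l=1}^{t-1}\hat P_T^{-k}(s_{l+1}\mid s_l,a^1_l,a^2_l)}{\hat p_{b,t}^{-k}(s_t,a^1_t,a^2_t)}-\frac{P_I(s_1)\prod_{l=1}^{t-1}P_T(s_{l+1}\mid s_l,a^1_l,a^2_l)}{p^{\pi^b}_t(s_t,a^1_t,a^2_t)}\Big)^2\Big]=o(n^{-2\alpha_2}).$$ 5. $\Upsilon^*_{\mathrm{DRL}}>0$, where, with expectation over one trajectory drawn under $\pi^b$, $$\Upsilon^*_{\mathrm{DRL}}=\sup_{\pi\in\Pi}\mathbb E\Big[\Big(\sum_{t=1}^T\gamma^{t-1}\big(\mu_t(r_t-Q_t)+\mu_{t-1}V_t\big)\Big)^2\Big].$$ Then there is $C>0$ such that for every $\delta>0$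 there is $N_\delta>0$ such that for every $n\ge N_\delta$, with probability at least $1-2\delta$, $$\big|v^{\exp}_\Pi(\pi^e)-\hat v^{\exp}_{\mathrm{DRL}}(\pi^e)\big|\le C\Big(\kappa(\Pi)+\sqrt{\log(1/\delta)}\Big)\sqrt{\Upsilon^*_{\mathrm{DRL}}/n}.$$ (For $\delta\ge\frac12$ the claim is trivial; $\sqrt{\log(1/\delta)}$ is read as $0$ for $\delta>1$.) -/

import Mathlib

open MeasureTheory Filter Topology
open scoped ENNReal

noncomputable section

namespace TZMG

/-- A Markov policy of one player over the horizon `T`: at every step and state, a probability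
distribution on the player's finite action set. Steps are numbered `0, …, T - 1`. -/
abbrev Policy (T : ℕ) (S A : Type*) [Fintype A] : Type _ := Fin T → S → stdSimplex ℝ A

/-- A policy profile of the two players. -/
abbrev Profile (T : ℕ) (S A₁ A₂ : Type*) [Fintype A₁] [Fintype A₂] : Type _ :=
  Policy T S A₁ × Policy T S A₂

/-- The states and actions of a trajectory: `s_0, …, s_T`, and the actions of both players at the
steps `0, …, T - 1`. -/
abbrev Path (T : ℕ) (S A₁ A₂ : Type*) : Type _ :=
  (Fin (T + 1) → S) × (Fin T → A₁) × (Fin T → A₂)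

/-- An observed trajectory: a path together with the rewards of player 1. -/
abbrev Traj (T : ℕ) (S A₁ A₂ : Type*) : Type _ := Path T S A₁ A₂ × (Fin T → ℝ)

/-- A two-player zero-sum Markov game (the horizon is a separate parameter). -/
structure Game (S A₁ A₂ : Type*) [Fintype S] where
  /-- initial state distribution -/
  init : stdSimplex ℝ S
  /-- transition probabilities -/
  trans : S → A₁ → A₂ → stdSimplex ℝ S
  /-- distribution of the reward of player 1 -/
  rewardLaw : S → A₁ → A₂ → ProbabilityMeasure ℝ
  /-- discount factor -/
  γ : ℝ
  γ_nonneg : 0 ≤ γ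
  γ_le_one : γ ≤ 1

/-- An estimated game model: initial distribution, transition function, mean reward function, and
the marginal state-action densities of the behavior profile at the steps `0, …, T - 1`. -/
structure ModelEstimate (T : ℕ) (S A₁ A₂ : Type*) where
  init : S → ℝ
  trans : S → A₁ → A₂ → S → ℝ
  reward : S → A₁ → A₂ → ℝ
  behav : Fin T → S → A₁ → A₂ → ℝ

variable {T : ℕ} {S A₁ A₂ : Type*} [Fintype S] [Fintype A₁] [Fintype A₂]

/-- The probability that the profile `π` plays `(a₁, a₂)` in state `s` at step `t`
(only `t < T` is ever used). -/
def Profile.prob (π : Profile T S A₁ A₂) (t : ℕ) (s : S) (a₁ : A₁) (a₂ : A₂) : ℝ :=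
  if h : t < T then (π.1 ⟨t, h⟩ s).1 a₁ * (π.2 ⟨t, h⟩ s).1 a₂ else 0

/-- The marginal state-action density `p^π_t` of a model with initial density `init` and
transition function `trans`. -/
def marginal (init : S → ℝ) (trans : S → A₁ → A₂ → S → ℝ) (π : Profile T S A₁ A₂) :
    ℕ → S → A₁ → A₂ → ℝ
  | 0 => fun s a₁ a₂ => π.prob 0 s a₁ a₂ * init s
  | t + 1 => fun s a₁ a₂ => π.prob (t + 1) s a₁ a₂ *
      ∑ s', ∑ b₁, ∑ b₂, trans s' b₁ b₂ s * marginal init trans π t s' b₁ b₂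

/-- The value of state `s` under `π` when `m` steps remain, i.e. at step `T - m`, in the model with
mean reward `reward` and transition function `trans`. -/
def valueRemaining (γ : ℝ) (reward : S → A₁ → A₂ → ℝ) (trans : S → A₁ → A₂ → S → ℝ)
    (π : Profile T S A₁ A₂) : ℕ → S → ℝ
  | 0 => fun _ => 0
  | m + 1 => fun s => ∑ a₁, ∑ a₂, π.prob (T - (m + 1)) s a₁ a₂ *
      (reward s a₁ a₂ + γ * ∑ s', trans s a₁ a₂ s' * valueRemaining γ reward trans π m s')

/-- State value function `V_t` of player 1 under `π`; it is `0` after the horizon. -/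
def stateValue (γ : ℝ) (reward : S → A₁ → A₂ → ℝ) (trans : S → A₁ → A₂ → S → ℝ)
    (π : Profile T S A₁ A₂) (t : ℕ) : S → ℝ :=
  valueRemaining γ reward trans π (T - t)

/-- State-action value function `Q_t` of player 1 under `π`. -/
def actionValue (γ : ℝ) (reward : S → A₁ → A₂ → ℝ) (trans : S → A₁ → A₂ → S → ℝ)
    (π : Profile T S A₁ A₂) (t : ℕ) (s : S) (a₁ : A₁) (a₂ : A₂) : ℝ :=
  reward s a₁ a₂ + γ * ∑ s', trans s a₁ a₂ s' * stateValue γ reward trans π (t + 1) s'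

/-- The doubly robust score
`∑_t γ^t (μ_t (r_t - Q_t) + μ_{t-1} V_t)` of one trajectory, with `μ_{-1} = 1`. -/
def score (γ : ℝ) (μ Q : Fin T → S → A₁ → A₂ → ℝ) (V : Fin T → S → ℝ)
    (x : Traj T S A₁ A₂) : ℝ :=
  ∑ t : Fin T, γ ^ (t : ℕ) *
    (μ t (x.1.1 t.castSucc) (x.1.2.1 t) (x.1.2.2 t) *
        (x.2 t - Q t (x.1.1 t.castSucc) (x.1.2.1 t) (x.1.2.2 t))
      + (if (t : ℕ) = 0 then 1 else
          let u : Fin T := ⟨(t : ℕ) - 1, lt_of_le_of_lt (Nat.sub_le _ _) t.isLt⟩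
          μ u (x.1.1 u.castSucc) (x.1.2.1 u) (x.1.2.2 u)) * V t (x.1.1 t.castSucc))

namespace Game

variable (G : Game S A₁ A₂)

/-- Transition probabilities as a real-valued function. -/
def transFn (s : S) (a₁ : A₁) (a₂ : A₂) (s' : S) : ℝ := (G.trans s a₁ a₂).1 s'

/-- Mean reward function. -/
def meanReward (s : S) (a₁ : A₁) (a₂ : A₂) : ℝ := ∫ r, r ∂(G.rewardLaw s a₁ a₂ : Measure ℝ)

/-- Probability of a path when both players follow `π`. -/
def pathWeight (π : Profile T S A₁ A₂) (z : Path T S A₁ A₂) : ℝ :=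
  G.init.1 (z.1 0) * ∏ t : Fin T, π.prob t (z.1 t.castSucc) (z.2.1 t) (z.2.2 t) *
    G.transFn (z.1 t.castSucc) (z.2.1 t) (z.2.2 t) (z.1 t.succ)

/-- The law of a trajectory when both players follow `π`: the path has probability `pathWeight`,
and given the path the rewards are independent with the reward distributions of the visited
state-action triples. -/
def trajLaw [MeasurableSpace S] [MeasurableSpace A₁] [MeasurableSpace A₂]
    (π : Profile T S A₁ A₂) : Measure (Traj T S A₁ A₂) :=
  Measure.sum fun z : Path T S A₁ A₂ =>
    ENNReal.ofReal (G.pathWeight π z) •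
      Measure.map (fun r : Fin T → ℝ => (z, r))
        (Measure.pi fun t : Fin T =>
          (G.rewardLaw (z.1 t.castSucc) (z.2.1 t) (z.2.2 t) : Measure ℝ))

/-- The law of the historical data: `n` independent trajectories of the behavior profile `πb`. -/
def dataLaw [MeasurableSpace S] [MeasurableSpace A₁] [MeasurableSpace A₂]
    (πb : Profile T S A₁ A₂) (n : ℕ) : Measure (Fin n → Traj T S A₁ A₂) :=
  Measure.pi fun _ => G.trajLaw πb

/-- The discounted value of player 1. Player 2 receives the opposite value. -/
def value [MeasurableSpace S] [MeasurableSpace A₁] [MeasurableSpace A₂]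
    (π : Profile T S A₁ A₂) : ℝ :=
  ∫ x, ∑ t : Fin T, G.γ ^ (t : ℕ) * x.2 t ∂(G.trajLaw π)

/-- The exploitability of `πe` relative to the policy classes `Pi₁`, `Pi₂`. -/
def exploitability [MeasurableSpace S] [MeasurableSpace A₁] [MeasurableSpace A₂]
    (Pi₁ : Set (Policy T S A₁)) (Pi₂ : Set (Policy T S A₂)) (πe : Profile T S A₁ A₂) : ℝ :=
  (⨆ p₁ : Pi₁, G.value ((p₁ : Policy T S A₁), πe.2)) +
    ⨆ p₂ : Pi₂, -G.value (πe.1, (p₂ : Policy T S A₂))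

/-- True marginal state-action distribution `p^π_t`. -/
def occupancy (π : Profile T S A₁ A₂) (t : ℕ) : S → A₁ → A₂ → ℝ :=
  marginal G.init.1 G.transFn π t

/-- Marginal density ratio `μ_t` of `π` with respect to the behavior profile `πb`. -/
def densityRatio (πb π : Profile T S A₁ A₂) (t : Fin T) (s : S) (a₁ : A₁) (a₂ : A₂) : ℝ :=
  G.occupancy π t s a₁ a₂ / G.occupancy πb t s a₁ a₂

/-- The score of a trajectory for the profile `π` with the true nuisance functions. -/
def oracleScore (πb π : Profile T S A₁ A₂) : Traj T S A₁ A₂ → ℝ :=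
  score G.γ (G.densityRatio πb π)
    (fun t => actionValue G.γ G.meanReward G.transFn π t)
    (fun t => stateValue G.γ G.meanReward G.transFn π t)

/-- `Υ*`: the supremum over the profile class of the second moment of the oracle score under the
behavior profile. -/
def upsilonStar [MeasurableSpace S] [MeasurableSpace A₁] [MeasurableSpace A₂]
    (πb : Profile T S A₁ A₂) (Pi : Set (Profile T S A₁ A₂)) : ℝ :=
  ⨆ π : Pi, ∫ x, G.oracleScore πb (π : Profile T S A₁ A₂) x ^ 2 ∂(G.trajLaw πb)

end Game

namespace ModelEstimate

/-- The estimated marginal density ratio of `π`: the marginal density of `π` in the estimated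
model over the estimated marginal density of the behavior profile. -/
def densityRatio (M : ModelEstimate T S A₁ A₂) (π : Profile T S A₁ A₂)
    (t : Fin T) (s : S) (a₁ : A₁) (a₂ : A₂) : ℝ :=
  marginal M.init M.trans π t s a₁ a₂ / M.behav t s a₁ a₂

/-- The estimated `Q_t` of `π`, computed in the estimated model. -/
def actionValue (M : ModelEstimate T S A₁ A₂) (γ : ℝ) (π : Profile T S A₁ A₂)
    (t : Fin T) (s : S) (a₁ : A₁) (a₂ : A₂) : ℝ :=
  TZMG.actionValue γ M.reward M.trans π t s a₁ a₂

/-- The estimated state value: the mean of the estimated `Q_t` over actions drawn from `π`. -/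
def stateValue (M : ModelEstimate T S A₁ A₂) (γ : ℝ) (π : Profile T S A₁ A₂)
    (t : Fin T) (s : S) : ℝ :=
  ∑ a₁, ∑ a₂, π.prob t s a₁ a₂ * M.actionValue γ π t s a₁ a₂

end ModelEstimate

/-- A cross-fitting rule: for every sample size `n` and every fold `k`, an estimated model computed
from the trajectories that do not belong to fold `k`. -/
abbrev CrossFit (T : ℕ) (S A₁ A₂ : Type*) (K : ℕ) (fold : (n : ℕ) → Fin n → Fin K) : Type _ :=
  (n : ℕ) → (k : Fin K) → ({i : Fin n // fold n i ≠ k} → Traj T S A₁ A₂) →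
    ModelEstimate T S A₁ A₂

namespace CrossFit

variable {K : ℕ} {fold : (n : ℕ) → Fin n → Fin K}

/-- The model fitted on the data `D` without fold `k`. -/
def fit (E : CrossFit T S A₁ A₂ K fold) (n : ℕ) (k : Fin K) (D : Fin n → Traj T S A₁ A₂) :
    ModelEstimate T S A₁ A₂ :=
  E n k fun i => D i

/-- All components of the fitted models are measurable functions of the data. -/
def IsMeasurable [MeasurableSpace S] [MeasurableSpace A₁] [MeasurableSpace A₂]
    (E : CrossFit T S A₁ A₂ K fold) : Prop :=
  ∀ (n : ℕ) (k : Fin K),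
    (∀ s, Measurable fun D => (E n k D).init s) ∧
    (∀ s a₁ a₂ s', Measurable fun D => (E n k D).trans s a₁ a₂ s') ∧
    (∀ s a₁ a₂, Measurable fun D => (E n k D).reward s a₁ a₂) ∧
    (∀ t s a₁ a₂, Measurable fun D => (E n k D).behav t s a₁ a₂)

/-- The double reinforcement learning estimator of the value of player 1. -/
def drlValue (E : CrossFit T S A₁ A₂ K fold) (γ : ℝ) (n : ℕ) (D : Fin n → Traj T S A₁ A₂)
    (π : Profile T S A₁ A₂) : ℝ :=
  (1 / (n : ℝ)) * ∑ i : Fin n,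
    score γ ((E.fit n (fold n i) D).densityRatio π) ((E.fit n (fold n i) D).actionValue γ π)
      ((E.fit n (fold n i) D).stateValue γ π) (D i)

/-- The double reinforcement learning estimator of the exploitability. -/
def drlExploitability (E : CrossFit T S A₁ A₂ K fold) (γ : ℝ)
    (Pi₁ : Set (Policy T S A₁)) (Pi₂ : Set (Policy T S A₂)) (πe : Profile T S A₁ A₂)
    (n : ℕ) (D : Fin n → Traj T S A₁ A₂) : ℝ :=
  (⨆ p₁ : Pi₁, E.drlValue γ n D ((p₁ : Policy T S A₁), πe.2)) +
    ⨆ p₂ : Pi₂, -E.drlValue γ n D (πe.1, (p₂ : Policy T S A₂))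

/-- The estimators satisfy the same bounds as their targets: almost surely, at every step and every
state-action triple that the behavior profile visits at that step with positive probability,
`0 ≤ μ̂_t ≤ C^t` and `|Q̂_t| ≤ (T + 1 - t) Rmax` in the numbering of steps from `1`. -/
def Bounded [MeasurableSpace S] [MeasurableSpace A₁] [MeasurableSpace A₂]
    (E : CrossFit T S A₁ A₂ K fold) (G : Game S A₁ A₂) (πb : Profile T S A₁ A₂)
    (Pi : Set (Profile T S A₁ A₂)) (C Rmax : ℝ) : Prop :=
  ∀ (n : ℕ) (k : Fin K), ∀ᵐ D ∂(G.dataLaw πb n), ∀ π ∈ Pi, ∀ (t : Fin T) (s : S) (a₁ : A₁)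
    (a₂ : A₂), 0 < G.occupancy πb t s a₁ a₂ →
      0 ≤ (E.fit n k D).densityRatio π t s a₁ a₂ ∧
      (E.fit n k D).densityRatio π t s a₁ a₂ ≤ C ^ ((t : ℕ) + 1) ∧
      |(E.fit n k D).actionValue G.γ π t s a₁ a₂| ≤ ((T : ℝ) - (t : ℕ)) * Rmax

/-- The mean squared error of the estimated products of a mean reward and the preceding transition
probabilities is `o(n ^ (-2α))`. The triple at the initial step `t` ranges over those that the
behavior profile visits at step `t` with positive probability, the later states over all states,
and the later actions over those that the behavior profile plays with positive probability; the
expectation is over the data. -/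
def RewardTransRate [MeasurableSpace S] [MeasurableSpace A₁] [MeasurableSpace A₂]
    (E : CrossFit T S A₁ A₂ K fold) (G : Game S A₁ A₂) (πb : Profile T S A₁ A₂)
    (α : ℝ) : Prop :=
  ∀ (k : Fin K) (t t' : Fin T), t ≤ t' → ∀ z : Path T S A₁ A₂,
    0 < G.occupancy πb t (z.1 t.castSucc) (z.2.1 t) (z.2.2 t) →
    (∀ l : Fin T, t < l → l ≤ t' → 0 < πb.prob l (z.1 l.castSucc) (z.2.1 l) (z.2.2 l)) →
    Tendsto (fun n : ℕ => ENNReal.ofReal ((n : ℝ) ^ (2 * α)) *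
      ∫⁻ D, ENNReal.ofReal
        (((E.fit n k D).reward (z.1 t'.castSucc) (z.2.1 t') (z.2.2 t') *
            ∏ l ∈ Finset.Ico t t',
              (E.fit n k D).trans (z.1 l.castSucc) (z.2.1 l) (z.2.2 l) (z.1 l.succ)
          - G.meanReward (z.1 t'.castSucc) (z.2.1 t') (z.2.2 t') *
            ∏ l ∈ Finset.Ico t t',
              G.transFn (z.1 l.castSucc) (z.2.1 l) (z.2.2 l) (z.1 l.succ)) ^ 2)
        ∂(G.dataLaw πb n)) atTop (𝓝 0)

/-- The mean squared error of the estimated ratios of the product of the transition probabilities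
up to step `t` (starting with the initial probability) to the marginal behavior density at step `t`
is `o(n ^ (-2α))`. The triple at the final step `t` ranges over those that the behavior profile
visits at step `t` with positive probability, the earlier states over all states, and the earlier
actions over those that the behavior profile plays with positive probability; the expectation is
over the data. -/
def TransDensityRate [MeasurableSpace S] [MeasurableSpace A₁] [MeasurableSpace A₂]
    (E : CrossFit T S A₁ A₂ K fold) (G : Game S A₁ A₂) (πb : Profile T S A₁ A₂)
    (α : ℝ) : Prop :=
  ∀ (k : Fin K) (t : Fin T), ∀ z : Path T S A₁ A₂,
    0 < G.occupancy πb t (z.1 t.castSucc) (z.2.1 t) (z.2.2 t) →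
    (∀ l : Fin T, l < t → 0 < πb.prob l (z.1 l.castSucc) (z.2.1 l) (z.2.2 l)) →
    Tendsto (fun n : ℕ => ENNReal.ofReal ((n : ℝ) ^ (2 * α)) *
      ∫⁻ D, ENNReal.ofReal
        (((E.fit n k D).init (z.1 0) *
            (∏ l ∈ Finset.Iio t,
              (E.fit n k D).trans (z.1 l.castSucc) (z.2.1 l) (z.2.2 l) (z.1 l.succ)) /
            (E.fit n k D).behav t (z.1 t.castSucc) (z.2.1 t) (z.2.2 t)
          - G.init.1 (z.1 0) *
            (∏ l ∈ Finset.Iio t,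
              G.transFn (z.1 l.castSucc) (z.2.1 l) (z.2.2 l) (z.1 l.succ)) /
            G.occupancy πb t (z.1 t.castSucc) (z.2.1 t) (z.2.2 t)) ^ 2)
        ∂(G.dataLaw πb n)) atTop (𝓝 0)

end CrossFit

open Classical in
/-- Hamming distance of two profiles on `m` state trajectories: the fraction of the trajectories
along which the policies of at least one player differ at some step. -/
def hamming {m : ℕ} (x : Fin m → Fin T → S) (π π' : Profile T S A₁ A₂) : ℝ :=
  (1 / (m : ℝ)) * ∑ i : Fin m,
    if (∃ t, π.1 t (x i t) ≠ π'.1 t (x i t)) ∨ (∃ t, π.2 t (x i t) ≠ π'.2 t (x i t))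
      then 1 else 0

/-- Hamming covering number of `Pi` on given state trajectories. -/
def coveringOn {m : ℕ} (x : Fin m → Fin T → S) (Pi : Set (Profile T S A₁ A₂)) (ε : ℝ) : ℕ∞ :=
  ⨅ (F : Set (Profile T S A₁ A₂)) (_ : F ⊆ Pi)
    (_ : ∀ π ∈ Pi, ∃ π' ∈ F, hamming x π π' ≤ ε), F.encard

/-- Hamming covering number `N_H(ε, Pi)`: the supremum over all finite nonempty families of state
trajectories. -/
def coveringNumber (Pi : Set (Profile T S A₁ A₂)) (ε : ℝ) : ℕ∞ :=
  ⨆ (m : ℕ) (_ : 1 ≤ m) (x : Fin m → Fin T → S), coveringOn x Pi ε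

/-- The entropy integral `κ(Pi)`. -/
def entropyIntegral (Pi : Set (Profile T S A₁ A₂)) : ℝ :=
  ∫ ε in Set.Ioi (0 : ℝ), Real.sqrt (Real.log ((coveringNumber Pi (ε ^ 2)).toNat : ℝ))

end TZMG

end

/-!
The state and action spaces are finite, so there are finitely many paths, and along a given path
the score of any profile, with any nuisance functions, is affine in the rewards
(`score_eq_sum_pathTerm`). Hence all scores are linear combinations of finitely many functions
`Game.pathTerm` of a trajectory. The coefficients of the estimated scores depend on the profile and
on the data, but are almost surely bounded (`ModelEstimate.BoundedAt.abs_scoreCoeff_le`). The error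
of the estimated value of `π` is therefore, uniformly in `π`, at most the sum of two parts.

* The centered sums of the path terms over the folds, times a constant. These depend neither on `π`
  nor on the fitted models; Hoeffding's inequality and a union bound show that they are of order
  `√(log (1/δ) / n)` with probability at least `1 - δ` (`measure_exists_deviation_gt_le`).
* The bias, which is the difference between the mean of the estimated score under the law of a fresh
  trajectory, with the fitted model held fixed, and the value of `π`. It is bilinear in the errors of
  the density ratios and of the state-action values (`bias_identity`): the first-order terms vanish
  by the Bellman and the flow equations. Unrolling the recursions for `Q` and for the marginal
  densities along paths bounds both errors, for all profiles at once, by the errors of the products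
  in the rate assumptions (`abs_actionValue_sub_le`, `abs_marginal_div_sub_le`). By Markov's
  inequality these are at most `n ^ (-α₁)` and `n ^ (-α₂)` with probability tending to one
  (`CrossFit.tendsto_measure_not_accurate`), so the bias is of order
  `n ^ (-α₁ - α₂) ≤ n ^ (-1/2)`.

The difference of two suprema is at most the uniform difference of the functions, which carries the
bound over to the exploitability. The claim is void for `δ ≥ 1/2`; for smaller `δ` the number
`log (1/δ)` is at least `log 2`, so the term `√(log (1/δ))` alone dominates the bound, with a constant
that depends on the game, `C₀`, `Rmax`, the number of folds and `Υ*`, but not on `n` or `δ`.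
-/

namespace TZMG

/-! ### Marginals of path weights -/

section Paths

variable {S A₁ A₂ : Type*}

/-- The path `z` continued by the actions `a`, `b` and the state `s`. -/
def Path.snoc {m : ℕ} (z : Path m S A₁ A₂) (a : A₁) (b : A₂) (s : S) : Path (m + 1) S A₁ A₂ :=
  (Fin.snoc (α := fun _ => S) z.1 s, Fin.snoc (α := fun _ => A₁) z.2.1 a,
    Fin.snoc (α := fun _ => A₂) z.2.2 b)

/-- The weight of a path of any length `m` for an initial density, a transition function and
step-dependent action weights `p`. Unlike for `Game.pathWeight`, the steps are numbered by `ℕ`, which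
allows induction on the length. -/
def weight (init : S → ℝ) (trans : S → A₁ → A₂ → S → ℝ) (p : ℕ → S → A₁ → A₂ → ℝ) (m : ℕ)
    (z : Path m S A₁ A₂) : ℝ :=
  init (z.1 0) * ∏ t : Fin m, p t (z.1 t.castSucc) (z.2.1 t) (z.2.2 t) *
    trans (z.1 t.castSucc) (z.2.1 t) (z.2.2 t) (z.1 t.succ)

theorem weight_snoc (init : S → ℝ) (trans : S → A₁ → A₂ → S → ℝ) (p : ℕ → S → A₁ → A₂ → ℝ) {m : ℕ}
    (z : Path m S A₁ A₂) (a : A₁) (b : A₂) (s : S) :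
    weight init trans p (m + 1) (z.snoc a b s) = weight init trans p m z *
      (p m (z.1 (Fin.last m)) a b * trans (z.1 (Fin.last m)) a b s) := by
  have h0 : (z.snoc a b s).1 0 = z.1 0 := by
    simp only [Path.snoc]
    exact Fin.snoc_castSucc (α := fun _ => S) s z.1 0
  simp only [weight, Fin.prod_univ_castSucc, h0, mul_assoc]
  simp [Path.snoc, Fin.succ_castSucc, -Fin.castSucc_succ]

variable [Fintype S] [Fintype A₁] [Fintype A₂]

theorem sum_path_succ {m : ℕ} (f : Path (m + 1) S A₁ A₂ → ℝ) :
    ∑ z, f z = ∑ z : Path m S A₁ A₂, ∑ a, ∑ b, ∑ s, f (z.snoc a b s) := by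
  let e : (Path m S A₁ A₂) × (A₁ × A₂ × S) ≃ Path (m + 1) S A₁ A₂ :=
    { toFun := fun x => x.1.snoc x.2.1 x.2.2.1 x.2.2.2
      invFun := fun y => ((Fin.init y.1, Fin.init y.2.1, Fin.init y.2.2),
        y.2.1 (Fin.last m), y.2.2 (Fin.last m), y.1 (Fin.last (m + 1)))
      left_inv := fun x => by simp [Path.snoc]
      right_inv := fun y => by simp [Path.snoc] }
  rw [← e.sum_comp, Fintype.sum_prod_type]
  simp only [Fintype.sum_prod_type]
  rfl

/-- The marginal density of the state at step `t`, without the action at that step. -/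
def stateMarginal (init : S → ℝ) (trans : S → A₁ → A₂ → S → ℝ) (p : ℕ → S → A₁ → A₂ → ℝ) :
    ℕ → S → ℝ
  | 0 => init
  | t + 1 => fun s => ∑ s', ∑ b₁, ∑ b₂, trans s' b₁ b₂ s *
      (p t s' b₁ b₂ * stateMarginal init trans p t s')

theorem marginal_eq {T : ℕ} (init : S → ℝ) (trans : S → A₁ → A₂ → S → ℝ)
    (π : Profile T S A₁ A₂) (t : ℕ) (s : S) (a : A₁) (b : A₂) :
    marginal init trans π t s a b = π.prob t s a b * stateMarginal init trans π.prob t s := by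
  induction t generalizing s a b with
  | zero => rfl
  | succ t ih => simp only [marginal, stateMarginal, ih]

theorem sum_weight_last (init : S → ℝ) (trans : S → A₁ → A₂ → S → ℝ) (p : ℕ → S → A₁ → A₂ → ℝ)
    (m : ℕ) (h : S → ℝ) :
    ∑ z, weight init trans p m z * h (z.1 (Fin.last m)) =
      ∑ s, stateMarginal init trans p m s * h s := by
  induction m generalizing h with
  | zero =>
    let e : S ≃ Path 0 S A₁ A₂ :=
      { toFun := fun s => (fun _ => s, Fin.elim0, Fin.elim0)
        invFun := fun z => z.1 0
        left_inv := fun s => rfl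
        right_inv := fun z => by
          refine Prod.ext (funext fun i => ?_) (Prod.ext (funext fun i => i.elim0)
            (funext fun i => i.elim0))
          rw [Subsingleton.elim (α := Fin 1) i 0] }
    rw [← e.sum_comp]
    simp [weight, stateMarginal, e]
  | succ m ih =>
    rw [sum_path_succ]
    have h1 : ∀ (z : Path m S A₁ A₂) a b s, (z.snoc a b s).1 (Fin.last (m + 1)) = s := by
      intro z a b s; simp [Path.snoc]
    simp only [weight_snoc, h1, mul_assoc, ← Finset.mul_sum]
    rw [ih (fun s' => ∑ a, ∑ b, p m s' a b * ∑ s, trans s' a b s * h s)]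
    simp only [stateMarginal, Finset.sum_mul, Finset.mul_sum]
    refine Eq.trans (Finset.sum_congr rfl fun s' _ => ?_) Finset.sum_comm
    refine Eq.trans (Finset.sum_congr rfl fun a _ => ?_) Finset.sum_comm
    refine Eq.trans (Finset.sum_congr rfl fun b _ => ?_) Finset.sum_comm
    exact Finset.sum_congr rfl fun s _ => by ring

/-- The joint law of the state-action triple at step `t` and the next state, under the path
weights. -/
theorem sum_weight_step {init : S → ℝ} {trans : S → A₁ → A₂ → S → ℝ} {p : ℕ → S → A₁ → A₂ → ℝ}
    {m : ℕ} (htrans : ∀ s a b, ∑ s', trans s a b s' = 1)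
    (hp : ∀ t < m, ∀ s, ∑ a, ∑ b, p t s a b = 1) (t : Fin m) (f : S → A₁ → A₂ → S → ℝ) :
    ∑ z, weight init trans p m z *
        f (z.1 t.castSucc) (z.2.1 t) (z.2.2 t) (z.1 t.succ) =
      ∑ s, ∑ a, ∑ b, ∑ s', p t s a b * stateMarginal init trans p t s * trans s a b s' *
        f s a b s' := by
  induction m with
  | zero => exact t.elim0
  | succ m ih =>
    rw [sum_path_succ]
    induction t using Fin.lastCases with
    | last =>
      have h1 : ∀ (z : Path m S A₁ A₂) a b s, f ((z.snoc a b s).1 (Fin.last m).castSucc)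
          ((z.snoc a b s).2.1 (Fin.last m)) ((z.snoc a b s).2.2 (Fin.last m))
          ((z.snoc a b s).1 (Fin.last m).succ) = f (z.1 (Fin.last m)) a b s := by
        intro z a b s; simp [Path.snoc]
      simp only [weight_snoc, h1, mul_assoc, ← Finset.mul_sum]
      rw [sum_weight_last init trans p m
        (fun s' => ∑ a, ∑ b, p m s' a b * ∑ s, trans s' a b s * f s' a b s)]
      simp only [Finset.mul_sum, Fin.val_last]
      refine Finset.sum_congr rfl fun s _ => Finset.sum_congr rfl fun a _ =>
        Finset.sum_congr rfl fun b _ => Finset.sum_congr rfl fun s' _ => by ring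
    | cast t =>
      have h1 : ∀ (z : Path m S A₁ A₂) a b s, f ((z.snoc a b s).1 t.castSucc.castSucc)
          ((z.snoc a b s).2.1 t.castSucc) ((z.snoc a b s).2.2 t.castSucc)
          ((z.snoc a b s).1 t.castSucc.succ) =
            f (z.1 t.castSucc) (z.2.1 t) (z.2.2 t) (z.1 t.succ) := by
        intro z a b s; simp [Path.snoc, Fin.succ_castSucc, -Fin.castSucc_succ]
      rw [Fin.val_castSucc, ← ih (fun t ht => hp t (ht.trans (Nat.lt_succ_self m))) t]
      refine Finset.sum_congr rfl fun z _ => ?_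
      simp only [weight_snoc, h1, mul_right_comm _ _ (f _ _ _ _)]
      simp only [← Finset.mul_sum, htrans, mul_one, hp m (Nat.lt_succ_self m)]

theorem sum_stateMarginal {init : S → ℝ} {trans : S → A₁ → A₂ → S → ℝ} {p : ℕ → S → A₁ → A₂ → ℝ}
    {m : ℕ} (hinit : ∑ s, init s = 1) (htrans : ∀ s a b, ∑ s', trans s a b s' = 1)
    (hp : ∀ t < m, ∀ s, ∑ a, ∑ b, p t s a b = 1) :
    ∑ s, stateMarginal init trans p m s = 1 := by
  induction m with
  | zero => exact hinit
  | succ m ih =>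
    rw [← ih fun t ht => hp t (ht.trans (Nat.lt_succ_self m))]
    simp only [stateMarginal]
    rw [Finset.sum_comm]
    refine Finset.sum_congr rfl fun s' _ => ?_
    rw [Finset.sum_comm]
    simp only [Finset.sum_comm (s := (Finset.univ : Finset S)) (t := (Finset.univ : Finset A₂)),
      ← Finset.sum_mul, htrans, one_mul, hp m (Nat.lt_succ_self m)]

theorem stateMarginal_nonneg {init : S → ℝ} {trans : S → A₁ → A₂ → S → ℝ}
    {p : ℕ → S → A₁ → A₂ → ℝ} (hinit : ∀ s, 0 ≤ init s) (htrans : ∀ s a b s', 0 ≤ trans s a b s')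
    (hp : ∀ t s a b, 0 ≤ p t s a b) (t : ℕ) (s : S) : 0 ≤ stateMarginal init trans p t s := by
  induction t generalizing s with
  | zero => exact hinit s
  | succ t ih =>
    exact Finset.sum_nonneg fun s' _ => Finset.sum_nonneg fun a _ => Finset.sum_nonneg fun b _ =>
      mul_nonneg (htrans _ _ _ _) (mul_nonneg (hp _ _ _ _) (ih s'))

/-- States that are unreachable under some action weights are unreachable under all action weights
with a smaller support. -/
theorem stateMarginal_eq_zero {init : S → ℝ} {trans : S → A₁ → A₂ → S → ℝ}
    {p pb : ℕ → S → A₁ → A₂ → ℝ} (hinit : ∀ s, 0 ≤ init s) (htrans : ∀ s a b s', 0 ≤ trans s a b s')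
    (hpb : ∀ t s a b, 0 ≤ pb t s a b) (hzero : ∀ t s a b, pb t s a b = 0 → p t s a b = 0) (t : ℕ)
    (s : S) (h : stateMarginal init trans pb t s = 0) : stateMarginal init trans p t s = 0 := by
  induction t generalizing s with
  | zero => exact h
  | succ t ih =>
    have h0 : ∀ s' a b, 0 ≤ trans s' a b s * (pb t s' a b * stateMarginal init trans pb t s') :=
      fun s' a b => mul_nonneg (htrans _ _ _ _)
        (mul_nonneg (hpb _ _ _ _) (stateMarginal_nonneg hinit htrans hpb t s'))
    simp only [stateMarginal] at h ⊢
    refine Finset.sum_eq_zero fun s' hs' => Finset.sum_eq_zero fun a ha =>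
      Finset.sum_eq_zero fun b hb => ?_
    have h1 := (Finset.sum_eq_zero_iff_of_nonneg fun s' _ => Finset.sum_nonneg fun a _ =>
      Finset.sum_nonneg fun b _ => h0 s' a b).1 h s' hs'
    have h2 := (Finset.sum_eq_zero_iff_of_nonneg fun a _ =>
      Finset.sum_nonneg fun b _ => h0 s' a b).1 h1 a ha
    have h3 := (Finset.sum_eq_zero_iff_of_nonneg fun b _ => h0 s' a b).1 h2 b hb
    rcases mul_eq_zero.1 h3 with h4 | h4
    · rw [h4, zero_mul]
    · rcases mul_eq_zero.1 h4 with h5 | h5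
      · rw [hzero _ _ _ _ h5, zero_mul, mul_zero]
      · rw [ih s' h5, mul_zero, mul_zero]

end Paths

/-! ### The bias of a doubly robust score -/

section Bias

variable {S A₁ A₂ : Type*} [Fintype S] [Fintype A₁] [Fintype A₂]

/-- The measure of the next state (for `t + 1`) that results from the signed measures `ν t` of the
state-action triples; `ι` is its value at the initial step. -/
def push (ι : S → ℝ) (trans : S → A₁ → A₂ → S → ℝ) (ν : ℕ → S → A₁ → A₂ → ℝ) : ℕ → S → ℝ
  | 0 => ι
  | t + 1 => fun s => ∑ s', ∑ b₁, ∑ b₂, trans s' b₁ b₂ s * ν t s' b₁ b₂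

theorem push_sub (ι : S → ℝ) (trans : S → A₁ → A₂ → S → ℝ) (ν ν' : ℕ → S → A₁ → A₂ → ℝ) (t : ℕ)
    (s : S) : push ι trans ν t s = push ι trans ν' t s +
      push (fun _ => 0) trans (fun t s a b => ν t s a b - ν' t s a b) t s := by
  cases t with
  | zero => simp [push]
  | succ t =>
    simp only [push, ← Finset.sum_add_distrib]
    refine Finset.sum_congr rfl fun s _ => Finset.sum_congr rfl fun a _ =>
        Finset.sum_congr rfl fun b _ => by ring

theorem push_stateMarginal (init : S → ℝ) (trans : S → A₁ → A₂ → S → ℝ) (p : ℕ → S → A₁ → A₂ → ℝ)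
    (t : ℕ) (s : S) :
    push init trans (fun t s a b => p t s a b * stateMarginal init trans p t s) t s =
      stateMarginal init trans p t s := by
  cases t <;> rfl

theorem sum_push_succ_mul (ι : S → ℝ) (trans : S → A₁ → A₂ → S → ℝ) (ν : ℕ → S → A₁ → A₂ → ℝ)
    (t : ℕ) (h : S → ℝ) :
    ∑ s, push ι trans ν (t + 1) s * h s =
      ∑ s, ∑ a, ∑ b, ν t s a b * ∑ s', trans s a b s' * h s' := by
  simp only [push, Finset.sum_mul, Finset.mul_sum]
  refine Eq.trans Finset.sum_comm (Finset.sum_congr rfl fun s' _ => ?_)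
  refine Eq.trans Finset.sum_comm (Finset.sum_congr rfl fun a _ => ?_)
  refine Eq.trans Finset.sum_comm (Finset.sum_congr rfl fun b _ => ?_)
  exact Finset.sum_congr rfl fun s _ => by ring

/-- The error of the doubly robust functional is bilinear in the errors of its two nuisance
functions. Here `ν` stands for the estimated state-action densities, `p t s a b * m t s` with
`m = stateMarginal init trans p` for the true ones, `Q'` for the estimated and `Q` for the true
state-action values. The first-order terms vanish by the Bellman equations of `Q` (for errors of
`ν`) and by the flow equations of the true densities (for errors of `Q'`). -/
theorem bias_identity {T : ℕ} {γ : ℝ} {init : S → ℝ} {trans : S → A₁ → A₂ → S → ℝ}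
    {R : S → A₁ → A₂ → ℝ} {p : ℕ → S → A₁ → A₂ → ℝ} (ν Q' Q : ℕ → S → A₁ → A₂ → ℝ)
    (V' V : ℕ → S → ℝ) (hV' : ∀ t < T, ∀ s, V' t s = ∑ a, ∑ b, p t s a b * Q' t s a b)
    (hQ : ∀ t < T, ∀ s a b, Q t s a b = R s a b + γ * ∑ s', trans s a b s' * V (t + 1) s')
    (hVT : ∀ s, V T s = 0) :
    ∑ t ∈ Finset.range T, γ ^ t * (∑ s, ∑ a, ∑ b, ν t s a b * (R s a b - Q' t s a b) +
        ∑ s, push init trans ν t s * V' t s) -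
      ∑ t ∈ Finset.range T, γ ^ t *
        ∑ s, ∑ a, ∑ b, (p t s a b * stateMarginal init trans p t s) * R s a b =
    ∑ t ∈ Finset.range T, γ ^ t *
      (∑ s, ∑ a, ∑ b, (ν t s a b - p t s a b * stateMarginal init trans p t s) *
          (Q t s a b - Q' t s a b) +
        ∑ s, push (fun _ => 0) trans
          (fun t s a b => ν t s a b - p t s a b * stateMarginal init trans p t s) t s *
            (V' t s - V t s)) := by
  set m := stateMarginal init trans p with hm
  set Δ : ℕ → S → A₁ → A₂ → ℝ := fun t s a b => ν t s a b - p t s a b * m t s with hΔ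
  set g : ℕ → ℝ := fun t => γ ^ t * ∑ s, push (fun _ => 0) trans Δ t s * V t s with hg
  have hg0 : g 0 = 0 := by simp [hg, push]
  have hgT : g T = 0 := by simp [hg, hVT]
  have htel : ∑ t ∈ Finset.range T, g t = ∑ t ∈ Finset.range T, g (t + 1) := by
    have h1 := Finset.sum_range_succ g T
    have h2 := Finset.sum_range_succ' g T
    linarith
  have hterm : ∀ t ∈ Finset.range T,
      γ ^ t * (∑ s, ∑ a, ∑ b, ν t s a b * (R s a b - Q' t s a b) +
        ∑ s, push init trans ν t s * V' t s) -
      γ ^ t * ∑ s, ∑ a, ∑ b, (p t s a b * m t s) * R s a b =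
      γ ^ t * (∑ s, ∑ a, ∑ b, Δ t s a b * (Q t s a b - Q' t s a b) +
        ∑ s, push (fun _ => 0) trans Δ t s * (V' t s - V t s)) + g t - g (t + 1) := by
    intro t ht
    have ht := Finset.mem_range.1 ht
    have e1 : ∑ s, push init trans ν t s * V' t s =
        ∑ s, ∑ a, ∑ b, (p t s a b * m t s) * Q' t s a b +
          ∑ s, push (fun _ => 0) trans Δ t s * V' t s := by
      rw [← Finset.sum_add_distrib]
      refine Finset.sum_congr rfl fun s _ => ?_
      rw [push_sub init trans ν (fun t s a b => p t s a b * m t s), hm, push_stateMarginal, add_mul]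
      congr 1
      rw [hV' t ht, Finset.mul_sum]
      refine Finset.sum_congr rfl fun a _ => ?_
      rw [Finset.mul_sum]
      exact Finset.sum_congr rfl fun b _ => by ring
    have e2 : g (t + 1) = γ ^ t * ∑ s, ∑ a, ∑ b, Δ t s a b * (Q t s a b - R s a b) := by
      simp only [hg]
      rw [sum_push_succ_mul, pow_succ, mul_assoc]
      congr 1
      simp only [Finset.mul_sum _ _ γ]
      refine Finset.sum_congr rfl fun s _ => Finset.sum_congr rfl fun a _ =>
        Finset.sum_congr rfl fun b _ => ?_
      rw [hQ t ht]; ring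
    have e3 : ∑ s, push (fun _ => 0) trans Δ t s * (V' t s - V t s) =
        ∑ s, push (fun _ => 0) trans Δ t s * V' t s -
          ∑ s, push (fun _ => 0) trans Δ t s * V t s := by
      simp only [mul_sub, Finset.sum_sub_distrib]
    have e4 : ∑ s, ∑ a, ∑ b, ν t s a b * (R s a b - Q' t s a b) =
        ∑ s, ∑ a, ∑ b, Δ t s a b * (Q t s a b - Q' t s a b) -
          ∑ s, ∑ a, ∑ b, Δ t s a b * (Q t s a b - R s a b) +
        ∑ s, ∑ a, ∑ b, (p t s a b * m t s) * R s a b -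
        ∑ s, ∑ a, ∑ b, (p t s a b * m t s) * Q' t s a b := by
      simp only [← Finset.sum_sub_distrib, ← Finset.sum_add_distrib]
      exact Finset.sum_congr rfl fun s _ => Finset.sum_congr rfl fun a _ =>
        Finset.sum_congr rfl fun b _ => by simp only [hΔ]; ring
    rw [e1, e2, e3, e4]
    simp only [hg]
    ring
  rw [← Finset.sum_sub_distrib, Finset.sum_congr rfl hterm, Finset.sum_sub_distrib,
    Finset.sum_add_distrib, htel]
  ring

/-- The bias of the doubly robust functional is at most the product of the uniform errors of the
two nuisance functions, measured on the support of the behavior densities `pb t s a b * mb t s`. -/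
theorem abs_bias_le {T : ℕ} {γ : ℝ} (hγ0 : 0 ≤ γ) (hγ1 : γ ≤ 1) {init : S → ℝ}
    {trans : S → A₁ → A₂ → S → ℝ} {R : S → A₁ → A₂ → ℝ} {p pb : ℕ → S → A₁ → A₂ → ℝ}
    (hinit : ∀ s, 0 ≤ init s) (hinit1 : ∑ s, init s = 1)
    (htrans : ∀ s a b s', 0 ≤ trans s a b s') (htrans1 : ∀ s a b, ∑ s', trans s a b s' = 1)
    (hpb : ∀ t s a b, 0 ≤ pb t s a b) (hpb1 : ∀ t < T, ∀ s, ∑ a, ∑ b, pb t s a b = 1)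
    (hp : ∀ t s a b, 0 ≤ p t s a b) (hp1 : ∀ t < T, ∀ s, ∑ a, ∑ b, p t s a b = 1)
    (hov : ∀ t < T, ∀ s a b, pb t s a b = 0 → p t s a b = 0)
    (ν Q' Q : ℕ → S → A₁ → A₂ → ℝ)
    (V' V : ℕ → S → ℝ) (hV' : ∀ t < T, ∀ s, V' t s = ∑ a, ∑ b, p t s a b * Q' t s a b)
    (hV : ∀ t < T, ∀ s, V t s = ∑ a, ∑ b, p t s a b * Q t s a b)
    (hQ : ∀ t < T, ∀ s a b, Q t s a b = R s a b + γ * ∑ s', trans s a b s' * V (t + 1) s')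
    (hVT : ∀ s, V T s = 0) {ξ₁ ξ₂ : ℝ} (hξ₂ : 0 ≤ ξ₂)
    (hQerr : ∀ t < T, ∀ s a b, 0 < pb t s a b * stateMarginal init trans pb t s →
      |Q t s a b - Q' t s a b| ≤ ξ₁)
    (hνerr : ∀ t < T, ∀ s a b, |ν t s a b - p t s a b * stateMarginal init trans p t s| ≤
      pb t s a b * stateMarginal init trans pb t s * ξ₂) :
    |∑ t ∈ Finset.range T, γ ^ t * (∑ s, ∑ a, ∑ b, ν t s a b * (R s a b - Q' t s a b) +
        ∑ s, push init trans ν t s * V' t s) -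
      ∑ t ∈ Finset.range T, γ ^ t *
        ∑ s, ∑ a, ∑ b, (p t s a b * stateMarginal init trans p t s) * R s a b| ≤
      T * (2 * (ξ₁ * ξ₂)) := by
  rw [bias_identity ν Q' Q V' V hV' hQ hVT]
  set Δ : ℕ → S → A₁ → A₂ → ℝ :=
    fun t s a b => ν t s a b - p t s a b * stateMarginal init trans p t s with hΔ
  set mb := stateMarginal init trans pb with hmb
  have hmb0 : ∀ t s, 0 ≤ mb t s := stateMarginal_nonneg hinit htrans hpb
  have hmb1 : ∀ t ≤ T, ∑ s, mb t s = 1 := fun t ht =>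
    sum_stateMarginal hinit1 htrans1 fun u hu => hpb1 u (hu.trans_le ht)
  have hVerr : ∀ t < T, ∀ s, 0 < mb t s → |V' t s - V t s| ≤ ξ₁ := by
    intro t ht s hs
    rw [hV' t ht, hV t ht, abs_sub_comm]
    simp only [← Finset.sum_sub_distrib, ← mul_sub]
    calc |∑ a, ∑ b, p t s a b * (Q t s a b - Q' t s a b)|
        ≤ ∑ a, ∑ b, |p t s a b * (Q t s a b - Q' t s a b)| :=
          (Finset.abs_sum_le_sum_abs _ _).trans
            (Finset.sum_le_sum fun a _ => Finset.abs_sum_le_sum_abs _ _)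
      _ ≤ ∑ a, ∑ b, p t s a b * ξ₁ := by
          refine Finset.sum_le_sum fun a _ => Finset.sum_le_sum fun b _ => ?_
          rw [abs_mul, abs_of_nonneg (hp t s a b)]
          rcases (hpb t s a b).eq_or_lt' with h | h
          · simp [hov t ht s a b h]
          · exact mul_le_mul_of_nonneg_left (hQerr t ht s a b (mul_pos h hs)) (hp t s a b)
      _ = ξ₁ := by simp only [← Finset.sum_mul, hp1 t ht s, one_mul]
  have h1 : ∀ t < T, |∑ s, ∑ a, ∑ b, Δ t s a b * (Q t s a b - Q' t s a b)| ≤ ξ₁ * ξ₂ := by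
    intro t ht
    calc |∑ s, ∑ a, ∑ b, Δ t s a b * (Q t s a b - Q' t s a b)|
        ≤ ∑ s, ∑ a, ∑ b, |Δ t s a b * (Q t s a b - Q' t s a b)| :=
          (Finset.abs_sum_le_sum_abs _ _).trans (Finset.sum_le_sum fun s _ =>
            (Finset.abs_sum_le_sum_abs _ _).trans
              (Finset.sum_le_sum fun a _ => Finset.abs_sum_le_sum_abs _ _))
      _ ≤ ∑ s, ∑ a, ∑ b, pb t s a b * (mb t s * (ξ₁ * ξ₂)) := by
          refine Finset.sum_le_sum fun s _ => Finset.sum_le_sum fun a _ =>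
            Finset.sum_le_sum fun b _ => ?_
          have hd : 0 ≤ pb t s a b * mb t s := mul_nonneg (hpb t s a b) (hmb0 t s)
          have hν := hνerr t ht s a b
          rw [abs_mul]
          rcases hd.eq_or_lt' with h | h
          · rw [h, zero_mul] at hν
            rw [show |Δ t s a b| = 0 from le_antisymm hν (abs_nonneg _), zero_mul, ← mul_assoc, h,
              zero_mul]
          · calc |Δ t s a b| * |Q t s a b - Q' t s a b|
                ≤ (pb t s a b * mb t s * ξ₂) * ξ₁ :=
                  mul_le_mul hν (hQerr t ht s a b h) (abs_nonneg _) (mul_nonneg hd hξ₂)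
              _ = pb t s a b * (mb t s * (ξ₁ * ξ₂)) := by ring
      _ = ξ₁ * ξ₂ := by
          simp only [← Finset.sum_mul, hpb1 t ht, one_mul, hmb1 t ht.le]
  have h2 : ∀ t < T, |∑ s, push (fun _ => 0) trans Δ t s * (V' t s - V t s)| ≤ ξ₁ * ξ₂ := by
    intro t ht
    have hpush : ∀ s, |push (fun _ => 0) trans Δ t s| ≤ mb t s * ξ₂ := by
      intro s
      cases t with
      | zero => simpa [push] using mul_nonneg (hmb0 0 s) hξ₂
      | succ t =>
        calc |push (fun _ => 0) trans Δ (t + 1) s|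
            ≤ ∑ s', ∑ a, ∑ b, |trans s' a b s * Δ t s' a b| :=
              (Finset.abs_sum_le_sum_abs _ _).trans (Finset.sum_le_sum fun s _ =>
                (Finset.abs_sum_le_sum_abs _ _).trans
                  (Finset.sum_le_sum fun a _ => Finset.abs_sum_le_sum_abs _ _))
          _ ≤ ∑ s', ∑ a, ∑ b, trans s' a b s * (pb t s' a b * mb t s') * ξ₂ := by
              refine Finset.sum_le_sum fun s' _ => Finset.sum_le_sum fun a _ =>
                Finset.sum_le_sum fun b _ => ?_
              rw [abs_mul, abs_of_nonneg (htrans _ _ _ _), mul_assoc]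
              exact mul_le_mul_of_nonneg_left (hνerr t (Nat.lt_of_succ_lt ht) s' a b)
                (htrans _ _ _ _)
          _ = mb (t + 1) s * ξ₂ := by
              simp only [hmb, stateMarginal, Finset.sum_mul]
    calc |∑ s, push (fun _ => 0) trans Δ t s * (V' t s - V t s)|
        ≤ ∑ s, |push (fun _ => 0) trans Δ t s * (V' t s - V t s)| :=
          Finset.abs_sum_le_sum_abs _ _
      _ ≤ ∑ s, mb t s * (ξ₁ * ξ₂) := by
          refine Finset.sum_le_sum fun s _ => ?_
          rw [abs_mul]
          have hν := hpush s
          rcases (hmb0 t s).eq_or_lt' with h | h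
          · rw [h, zero_mul] at hν
            rw [show |push (fun _ => 0) trans Δ t s| = 0 from le_antisymm hν (abs_nonneg _),
              zero_mul, h, zero_mul]
          · calc _ ≤ (mb t s * ξ₂) * ξ₁ :=
                  mul_le_mul hν (hVerr t ht s h) (abs_nonneg _) (mul_nonneg h.le hξ₂)
              _ = mb t s * (ξ₁ * ξ₂) := by ring
      _ = ξ₁ * ξ₂ := by rw [← Finset.sum_mul, hmb1 t ht.le, one_mul]
  calc _ ≤ ∑ t ∈ Finset.range T, 2 * (ξ₁ * ξ₂) := by
        refine (Finset.abs_sum_le_sum_abs _ _).trans (Finset.sum_le_sum fun t ht => ?_)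
        have ht := Finset.mem_range.1 ht
        rw [abs_mul, abs_of_nonneg (pow_nonneg hγ0 t)]
        calc _ ≤ 1 * (ξ₁ * ξ₂ + ξ₁ * ξ₂) :=
              mul_le_mul (pow_le_one₀ hγ0 hγ1)
                ((abs_add_le _ _).trans (add_le_add (h1 t ht) (h2 t ht))) (abs_nonneg _)
                zero_le_one
          _ = 2 * (ξ₁ * ξ₂) := by ring
    _ = T * (2 * (ξ₁ * ξ₂)) := by simp

/-- The mean of a score under path weights with normalized kernels, when the rewards are replaced
by a function of the visited triples. -/
theorem sum_weight_score {T : ℕ} (γ : ℝ) {init : S → ℝ} {trans : S → A₁ → A₂ → S → ℝ}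
    {pb : ℕ → S → A₁ → A₂ → ℝ} (R : S → A₁ → A₂ → ℝ)
    (htrans1 : ∀ s a b, ∑ s', trans s a b s' = 1)
    (hpb1 : ∀ t < T, ∀ s, ∑ a, ∑ b, pb t s a b = 1)
    (μ Q : ℕ → S → A₁ → A₂ → ℝ) (V : ℕ → S → ℝ) :
    ∑ z : Path T S A₁ A₂, weight init trans pb T z *
      score γ (fun t : Fin T => μ t) (fun t => Q t) (fun t => V t)
        (z, fun t => R (z.1 t.castSucc) (z.2.1 t) (z.2.2 t)) =
    ∑ t ∈ Finset.range T, γ ^ t *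
      (∑ s, ∑ a, ∑ b, pb t s a b * stateMarginal init trans pb t s * μ t s a b *
          (R s a b - Q t s a b) +
        ∑ s, push init trans
          (fun t s a b => pb t s a b * stateMarginal init trans pb t s * μ t s a b) t s *
            V t s) := by
  rw [← Fin.sum_univ_eq_sum_range (fun t => γ ^ t *
      (∑ s, ∑ a, ∑ b, pb t s a b * stateMarginal init trans pb t s * μ t s a b *
          (R s a b - Q t s a b) +
        ∑ s, push init trans
          (fun t s a b => pb t s a b * stateMarginal init trans pb t s * μ t s a b) t s *
            V t s))]
  simp only [score, Finset.mul_sum]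
  rw [Finset.sum_comm]
  refine Finset.sum_congr rfl fun t _ => ?_
  simp only [mul_left_comm (weight init trans pb T _)]
  rw [← Finset.mul_sum]
  congr 1
  simp only [mul_add, Finset.sum_add_distrib]
  congr 1
  · rw [sum_weight_step htrans1 hpb1 t (fun s a b _ => μ t s a b * (R s a b - Q t s a b))]
    refine Finset.sum_congr rfl fun s _ => Finset.sum_congr rfl fun a _ =>
      Finset.sum_congr rfl fun b _ => ?_
    simp only [← Finset.sum_mul, ← Finset.mul_sum, htrans1]
    ring
  · obtain ⟨t, ht⟩ := t
    cases t with
    | zero =>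
      simp only [if_true, one_mul, push]
      rw [sum_weight_step htrans1 hpb1 ⟨0, ht⟩ (fun s _ _ _ => V 0 s)]
      refine Finset.sum_congr rfl fun s _ => ?_
      simp only [mul_right_comm _ _ (V 0 s), ← Finset.mul_sum, htrans1, mul_one]
      simp only [mul_assoc, ← Finset.sum_mul, hpb1 0 ht, one_mul, stateMarginal]
      exact mul_comm _ _
    | succ u =>
      have hu : u < T := Nat.lt_of_succ_lt ht
      have h := sum_weight_step (init := init) htrans1 hpb1 ⟨u, hu⟩
        (fun s a b s' => μ u s a b * V (u + 1) s')
      rw [sum_push_succ_mul]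
      simp only [Nat.add_eq_zero_iff, one_ne_zero, and_false, if_false]
      refine Eq.trans h ?_
      refine Finset.sum_congr rfl fun s _ => Finset.sum_congr rfl fun a _ =>
        Finset.sum_congr rfl fun b _ => ?_
      rw [Finset.mul_sum]
      exact Finset.sum_congr rfl fun s' _ => by ring

end Bias

/-! ### Errors of estimated values and density ratios -/

section Nuisance

variable {T : ℕ} {S A₁ A₂ : Type*}

/-- The path `z` with the state and the actions at step `u` replaced. -/
def Path.update (z : Path T S A₁ A₂) (u : Fin T) (s : S) (a : A₁) (b : A₂) : Path T S A₁ A₂ :=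
  (Function.update z.1 u.castSucc s, Function.update z.2.1 u a, Function.update z.2.2 u b)

/-- The value of a function of a transition at step `l` of a path. -/
def Path.step (f : S → A₁ → A₂ → S → ℝ) (z : Path T S A₁ A₂) (l : Fin T) : ℝ :=
  f (z.1 l.castSucc) (z.2.1 l) (z.2.2 l) (z.1 l.succ)

section Update

variable (f : S → A₁ → A₂ → S → ℝ) (z : Path T S A₁ A₂) {u l : Fin T} (s : S) (a : A₁) (b : A₂)

@[simp] theorem Path.update_fst_same : (z.update u s a b).1 u.castSucc = s := by
  simp [Path.update]

@[simp] theorem Path.update_act₁_same : (z.update u s a b).2.1 u = a := by simp [Path.update]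

@[simp] theorem Path.update_act₂_same : (z.update u s a b).2.2 u = b := by simp [Path.update]

theorem Path.update_fst_of_ne {i : Fin (T + 1)} (h : (i : ℕ) ≠ u) :
    (z.update u s a b).1 i = z.1 i :=
  Function.update_of_ne (fun h' => h (by rw [h']; rfl)) _ _

theorem Path.update_act₁_of_ne (h : l ≠ u) : (z.update u s a b).2.1 l = z.2.1 l :=
  Function.update_of_ne h _ _

theorem Path.update_act₂_of_ne (h : l ≠ u) : (z.update u s a b).2.2 l = z.2.2 l :=
  Function.update_of_ne h _ _

theorem Path.update_castSucc_of_ne (h : l ≠ u) :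
    (z.update u s a b).1 l.castSucc = z.1 l.castSucc :=
  z.update_fst_of_ne s a b fun h' => h (Fin.ext h')

theorem Path.step_update_of_ne (h : l ≠ u) (h' : (l : ℕ) + 1 ≠ u) :
    (z.update u s a b).step f l = z.step f l := by
  rw [Path.step, Path.update_castSucc_of_ne _ _ _ _ h, Path.update_act₁_of_ne _ _ _ _ h,
    Path.update_act₂_of_ne _ _ _ _ h, Path.update_fst_of_ne _ _ _ _ (by simpa using h'), Path.step]

theorem Path.step_update_pred (h : (l : ℕ) + 1 = u) :
    (z.update u s a b).step f l = f (z.1 l.castSucc) (z.2.1 l) (z.2.2 l) s := by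
  have hne : l ≠ u := fun h' => by subst h'; omega
  have hs : l.succ = u.castSucc := Fin.ext (by simpa using h)
  rw [Path.step, Path.update_castSucc_of_ne _ _ _ _ hne, Path.update_act₁_of_ne _ _ _ _ hne,
    Path.update_act₂_of_ne _ _ _ _ hne, hs, Path.update_fst_same]

theorem Path.step_update_same :
    (z.update u s a b).step f u = f s a b (z.1 u.succ) := by
  rw [Path.step, Path.update_fst_same, Path.update_act₁_same, Path.update_act₂_same,
    Path.update_fst_of_ne _ _ _ _ (by simp)]

end Update

variable [Fintype S] [Fintype A₁] [Fintype A₂]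

theorem Profile.prob_nonneg (π : Profile T S A₁ A₂) (t : ℕ) (s : S) (a : A₁) (b : A₂) :
    0 ≤ π.prob t s a b := by
  unfold Profile.prob
  split_ifs with h
  · exact mul_nonneg ((π.1 ⟨t, h⟩ s).2.1 a) ((π.2 ⟨t, h⟩ s).2.1 b)
  · exact le_rfl

theorem Profile.sum_prob (π : Profile T S A₁ A₂) (t : ℕ) (ht : t < T) (s : S) :
    ∑ a, ∑ b, π.prob t s a b = 1 := by
  simp only [Profile.prob, dif_pos ht, ← Finset.mul_sum]
  rw [(π.2 ⟨t, ht⟩ s).2.2]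
  simpa using (π.1 ⟨t, ht⟩ s).2.2

theorem Profile.prob_le_one (π : Profile T S A₁ A₂) (t : ℕ) (s : S) (a : A₁) (b : A₂) :
    π.prob t s a b ≤ 1 := by
  by_cases ht : t < T
  · rw [← π.sum_prob t ht s]
    exact (Finset.single_le_sum (f := fun b => π.prob t s a b)
      (fun b _ => π.prob_nonneg t s a b) (Finset.mem_univ b)).trans
        (Finset.single_le_sum (f := fun a => ∑ b, π.prob t s a b)
          (fun a _ => Finset.sum_nonneg fun b _ => π.prob_nonneg t s a b) (Finset.mem_univ a))
  · simp [Profile.prob, ht]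

/-- A sum over states and actions of quantities bounded by `B`, weighted by a profile, is at most
`|S| * B`; terms of weight zero need no bound. -/
theorem Profile.abs_sum_prob_mul_le (π : Profile T S A₁ A₂) {t : ℕ} (ht : t < T)
    (f : S → A₁ → A₂ → ℝ) {B : ℝ} (hf : ∀ s a b, 0 < π.prob t s a b → |f s a b| ≤ B) :
    |∑ s, ∑ a, ∑ b, π.prob t s a b * f s a b| ≤ Fintype.card S * B := by
  calc |∑ s, ∑ a, ∑ b, π.prob t s a b * f s a b|
      ≤ ∑ s, ∑ a, ∑ b, |π.prob t s a b * f s a b| :=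
        (Finset.abs_sum_le_sum_abs _ _).trans (Finset.sum_le_sum fun s _ =>
          (Finset.abs_sum_le_sum_abs _ _).trans
            (Finset.sum_le_sum fun a _ => Finset.abs_sum_le_sum_abs _ _))
    _ ≤ ∑ s, ∑ a, ∑ b, π.prob t s a b * B := by
        refine Finset.sum_le_sum fun s _ => Finset.sum_le_sum fun a _ =>
          Finset.sum_le_sum fun b _ => ?_
        rw [abs_mul, abs_of_nonneg (π.prob_nonneg t s a b)]
        rcases (π.prob_nonneg t s a b).eq_or_lt' with h | h
        · simp [h]
        · exact mul_le_mul_of_nonneg_left (hf s a b h) h.le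
    _ = Fintype.card S * B := by simp [← Finset.sum_mul, π.sum_prob t ht]

theorem stateValue_eq (γ : ℝ) (R : S → A₁ → A₂ → ℝ) (P : S → A₁ → A₂ → S → ℝ)
    (π : Profile T S A₁ A₂) {t : ℕ} (ht : t < T) (s : S) :
    stateValue γ R P π t s = ∑ a, ∑ b, π.prob t s a b * actionValue γ R P π t s a b := by
  have h1 : T - t = (T - (t + 1)) + 1 := by omega
  have h2 : T - ((T - (t + 1)) + 1) = t := by omega
  rw [stateValue, h1, valueRemaining, h2]
  rfl

theorem stateValue_horizon (γ : ℝ) (R : S → A₁ → A₂ → ℝ) (P : S → A₁ → A₂ → S → ℝ)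
    (π : Profile T S A₁ A₂) (s : S) : stateValue γ R P π T s = 0 := by
  rw [stateValue, Nat.sub_self, valueRemaining]

theorem actionValue_eq_sum (γ : ℝ) (R : S → A₁ → A₂ → ℝ) (P : S → A₁ → A₂ → S → ℝ)
    (π : Profile T S A₁ A₂) {t : ℕ} (ht : t + 1 < T) (s : S) (a : A₁) (b : A₂) :
    actionValue γ R P π t s a b = R s a b + γ * ∑ s', ∑ a', ∑ b', π.prob (t + 1) s' a' b' *
      (P s a b s' * actionValue γ R P π (t + 1) s' a' b') := by
  rw [actionValue]
  simp only [stateValue_eq γ R P π ht, Finset.mul_sum, mul_left_comm (P s a b _)]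

/-- State-action values of two models are close if the products of a mean reward and the preceding
transition probabilities are: the recursion is unrolled along paths, with the product of the
transition probabilities from step `t` to the current step `u` carried as a prefactor. -/
theorem abs_prod_mul_actionValue_sub_le {γ : ℝ} (hγ0 : 0 ≤ γ) (hγ1 : γ ≤ 1)
    {R R' : S → A₁ → A₂ → ℝ} {P P' : S → A₁ → A₂ → S → ℝ} {πb π : Profile T S A₁ A₂}
    (hov : ∀ t s a b, 0 < π.prob t s a b → 0 < πb.prob t s a b) {t : Fin T}
    {good : S → A₁ → A₂ → Prop} {ε : ℝ} (hε : 0 ≤ ε)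
    (H : ∀ t' : Fin T, t ≤ t' → ∀ z : Path T S A₁ A₂,
      good (z.1 t.castSucc) (z.2.1 t) (z.2.2 t) →
      (∀ l : Fin T, t < l → l ≤ t' → 0 < πb.prob l (z.1 l.castSucc) (z.2.1 l) (z.2.2 l)) →
      |R' (z.1 t'.castSucc) (z.2.1 t') (z.2.2 t') * ∏ l ∈ Finset.Ico t t', z.step P' l -
        R (z.1 t'.castSucc) (z.2.1 t') (z.2.2 t') * ∏ l ∈ Finset.Ico t t', z.step P l| ≤ ε)
    (m : ℕ) (u : Fin T) (htu : t ≤ u) (hu : (u : ℕ) + (m + 1) = T) (z : Path T S A₁ A₂)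
    (hz : good (z.1 t.castSucc) (z.2.1 t) (z.2.2 t))
    (hzp : ∀ l : Fin T, t < l → l ≤ u → 0 < πb.prob l (z.1 l.castSucc) (z.2.1 l) (z.2.2 l)) :
    |(∏ l ∈ Finset.Ico t u, z.step P' l) *
        actionValue γ R' P' π u (z.1 u.castSucc) (z.2.1 u) (z.2.2 u) -
      (∏ l ∈ Finset.Ico t u, z.step P l) *
        actionValue γ R P π u (z.1 u.castSucc) (z.2.1 u) (z.2.2 u)| ≤
      (1 + Fintype.card S : ℝ) ^ m * ε := by
  induction m generalizing u z with
  | zero =>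
    have h0 : ∀ (R : S → A₁ → A₂ → ℝ) (P : S → A₁ → A₂ → S → ℝ) s a b,
        actionValue γ R P π u s a b = R s a b := by
      intro R P s a b
      rw [actionValue, show (u : ℕ) + 1 = T from hu]
      simp [stateValue_horizon]
    rw [h0, h0, pow_zero, one_mul, mul_comm, mul_comm (∏ l ∈ Finset.Ico t u, z.step P l)]
    exact H u htu z hz hzp
  | succ m ih =>
    have huT : (u : ℕ) + 1 < T := by omega
    set v : Fin T := ⟨u + 1, huT⟩ with hv
    have htv : t < v := Fin.lt_def.2 (Nat.lt_succ_of_le (Fin.le_def.1 htu))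
    have huv : u < v := Fin.lt_def.2 (Nat.lt_succ_self _)
    have hIco : Finset.Ico t v = insert u (Finset.Ico t u) := by
      ext l
      simp only [Finset.mem_Ico, Finset.mem_insert, Fin.le_def, Fin.lt_def, Fin.ext_iff, hv]
      have := Fin.le_def.1 htu
      omega
    have hprod : ∀ (f : S → A₁ → A₂ → S → ℝ) s a b,
        ∏ l ∈ Finset.Ico t v, (z.update v s a b).step f l =
          (∏ l ∈ Finset.Ico t u, z.step f l) *
            f (z.1 u.castSucc) (z.2.1 u) (z.2.2 u) s := by
      intro f s a b
      rw [hIco, Finset.prod_insert (by simp), z.step_update_pred f s a b rfl, mul_comm]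
      congr 1
      refine Finset.prod_congr rfl fun l hl => z.step_update_of_ne f s a b ?_ ?_
      · exact (((Finset.mem_Ico.1 hl).2).trans huv).ne
      · have := Fin.lt_def.1 (Finset.mem_Ico.1 hl).2
        simp only [hv]; omega
    have hstep : ∀ s a b, 0 < π.prob v s a b →
        |(∏ l ∈ Finset.Ico t u, z.step P' l) * P' (z.1 u.castSucc) (z.2.1 u) (z.2.2 u) s *
            actionValue γ R' P' π v s a b -
          (∏ l ∈ Finset.Ico t u, z.step P l) * P (z.1 u.castSucc) (z.2.1 u) (z.2.2 u) s *
            actionValue γ R P π v s a b| ≤ (1 + Fintype.card S : ℝ) ^ m * ε := by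
      intro s a b hπ
      have h := ih v htv.le (by simp only [hv]; omega) (z.update v s a b)
        (by rwa [Path.update_castSucc_of_ne _ _ _ _ htv.ne, Path.update_act₁_of_ne _ _ _ _ htv.ne,
              Path.update_act₂_of_ne _ _ _ _ htv.ne])
        (by
          intro l hl hlv
          rcases hlv.eq_or_lt with rfl | hlv
          · simpa using hov _ _ _ _ hπ
          · rw [Path.update_castSucc_of_ne _ _ _ _ hlv.ne, Path.update_act₁_of_ne _ _ _ _ hlv.ne,
              Path.update_act₂_of_ne _ _ _ _ hlv.ne]
            exact hzp l hl (Fin.le_def.2 (Nat.lt_succ_iff.1 (Fin.lt_def.1 hlv))))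
      rwa [hprod, hprod, Path.update_fst_same, Path.update_act₁_same,
        Path.update_act₂_same] at h
    have hsum := π.abs_sum_prob_mul_le huT (fun s a b =>
      (∏ l ∈ Finset.Ico t u, z.step P' l) * P' (z.1 u.castSucc) (z.2.1 u) (z.2.2 u) s *
            actionValue γ R' P' π v s a b -
          (∏ l ∈ Finset.Ico t u, z.step P l) * P (z.1 u.castSucc) (z.2.1 u) (z.2.2 u) s *
            actionValue γ R P π v s a b) hstep
    have hH := H u htu z hz hzp
    rw [actionValue_eq_sum γ R P π huT, actionValue_eq_sum γ R' P' π huT]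
    set X := ∑ s, ∑ a, ∑ b, π.prob (u + 1) s a b *
      ((∏ l ∈ Finset.Ico t u, z.step P' l) * P' (z.1 u.castSucc) (z.2.1 u) (z.2.2 u) s *
            actionValue γ R' P' π v s a b -
          (∏ l ∈ Finset.Ico t u, z.step P l) * P (z.1 u.castSucc) (z.2.1 u) (z.2.2 u) s *
            actionValue γ R P π v s a b) with hX
    have hXeq : X = (∏ l ∈ Finset.Ico t u, z.step P' l) * ∑ s', ∑ a', ∑ b',
          π.prob (u + 1) s' a' b' * (P' (z.1 u.castSucc) (z.2.1 u) (z.2.2 u) s' *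
            actionValue γ R' P' π (u + 1) s' a' b') -
        (∏ l ∈ Finset.Ico t u, z.step P l) * ∑ s', ∑ a', ∑ b',
          π.prob (u + 1) s' a' b' * (P (z.1 u.castSucc) (z.2.1 u) (z.2.2 u) s' *
            actionValue γ R P π (u + 1) s' a' b') := by
      simp only [hX, Finset.mul_sum, ← Finset.sum_sub_distrib]
      exact Finset.sum_congr rfl fun s _ => Finset.sum_congr rfl fun a _ =>
        Finset.sum_congr rfl fun b _ => by ring
    have hγX : |γ * X| ≤ Fintype.card S * ((1 + Fintype.card S : ℝ) ^ m * ε) := by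
      rw [abs_mul, abs_of_nonneg hγ0]
      exact (mul_le_of_le_one_left (abs_nonneg _) hγ1).trans hsum
    have hone : (1 : ℝ) ≤ (1 + Fintype.card S : ℝ) ^ m :=
      one_le_pow₀ (by linarith [(Nat.cast_nonneg (Fintype.card S) : (0 : ℝ) ≤ _)])
    calc _ = |(R' (z.1 u.castSucc) (z.2.1 u) (z.2.2 u) * ∏ l ∈ Finset.Ico t u, z.step P' l -
        R (z.1 u.castSucc) (z.2.1 u) (z.2.2 u) * ∏ l ∈ Finset.Ico t u, z.step P l) + γ * X| := by
          rw [hXeq]; congr 1; ring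
      _ ≤ ε + Fintype.card S * ((1 + Fintype.card S : ℝ) ^ m * ε) :=
          (abs_add_le _ _).trans (add_le_add hH hγX)
      _ ≤ (1 + Fintype.card S : ℝ) ^ (m + 1) * ε := by
          rw [pow_succ]
          nlinarith [mul_le_mul_of_nonneg_right hone hε]

/-- The uniform error of a state-action value at the triples where products of a mean reward and
the following transition probabilities are estimated well. -/
theorem abs_actionValue_sub_le {γ : ℝ} (hγ0 : 0 ≤ γ) (hγ1 : γ ≤ 1)
    {R R' : S → A₁ → A₂ → ℝ} {P P' : S → A₁ → A₂ → S → ℝ} {πb π : Profile T S A₁ A₂}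
    (hov : ∀ t s a b, 0 < π.prob t s a b → 0 < πb.prob t s a b) {t : Fin T}
    {good : S → A₁ → A₂ → Prop} {ε : ℝ} (hε : 0 ≤ ε)
    (H : ∀ t' : Fin T, t ≤ t' → ∀ z : Path T S A₁ A₂,
      good (z.1 t.castSucc) (z.2.1 t) (z.2.2 t) →
      (∀ l : Fin T, t < l → l ≤ t' → 0 < πb.prob l (z.1 l.castSucc) (z.2.1 l) (z.2.2 l)) →
      |R' (z.1 t'.castSucc) (z.2.1 t') (z.2.2 t') * ∏ l ∈ Finset.Ico t t', z.step P' l -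
        R (z.1 t'.castSucc) (z.2.1 t') (z.2.2 t') * ∏ l ∈ Finset.Ico t t', z.step P l| ≤ ε)
    (s : S) (a : A₁) (b : A₂) (hs : good s a b) :
    |actionValue γ R' P' π t s a b - actionValue γ R P π t s a b| ≤
      (1 + Fintype.card S : ℝ) ^ T * ε := by
  have h := abs_prod_mul_actionValue_sub_le hγ0 hγ1 hov hε H (T - 1 - t) t le_rfl (by omega)
    (fun _ => s, fun _ => a, fun _ => b) hs
    (fun l h1 h2 => absurd (h1.trans_le h2) (lt_irrefl _))
  simp only [Finset.Ico_self, Finset.prod_empty, one_mul] at h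
  refine h.trans (mul_le_mul_of_nonneg_right (pow_le_pow_right₀ ?_ (by omega)) hε)
  linarith [(Nat.cast_nonneg (Fintype.card S) : (0 : ℝ) ≤ _)]

/-- Counterpart of `abs_prod_mul_actionValue_sub_le` for state marginals: the recursion is unrolled
backwards from step `t`, with the product of the transition probabilities from the current step `u`
to step `t` over the density at `t` carried as a factor. -/
theorem abs_stateMarginal_mul_prod_sub_le {ι ι' : S → ℝ} {P P' : S → A₁ → A₂ → S → ℝ}
    {πb π : Profile T S A₁ A₂} (hov : ∀ t s a b, 0 < π.prob t s a b → 0 < πb.prob t s a b)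
    {t : Fin T} {good : S → A₁ → A₂ → Prop} {d d' : S → A₁ → A₂ → ℝ} {ε : ℝ}
    (H : ∀ z : Path T S A₁ A₂, good (z.1 t.castSucc) (z.2.1 t) (z.2.2 t) →
      (∀ l : Fin T, l < t → 0 < πb.prob l (z.1 l.castSucc) (z.2.1 l) (z.2.2 l)) →
      |ι' (z.1 0) * (∏ l ∈ Finset.Iio t, z.step P' l) /
            d' (z.1 t.castSucc) (z.2.1 t) (z.2.2 t) -
          ι (z.1 0) * (∏ l ∈ Finset.Iio t, z.step P l) /
            d (z.1 t.castSucc) (z.2.1 t) (z.2.2 t)| ≤ ε)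
    (u : ℕ) (hu : u < T) (hut : u ≤ t) (z : Path T S A₁ A₂)
    (hz : good (z.1 t.castSucc) (z.2.1 t) (z.2.2 t))
    (hzp : ∀ l : Fin T, u ≤ l → l < t → 0 < πb.prob l (z.1 l.castSucc) (z.2.1 l) (z.2.2 l)) :
    |stateMarginal ι' P' π.prob u (z.1 (⟨u, hu⟩ : Fin T).castSucc) *
          (∏ l ∈ Finset.Ico ⟨u, hu⟩ t, z.step P' l) /
            d' (z.1 t.castSucc) (z.2.1 t) (z.2.2 t) -
        stateMarginal ι P π.prob u (z.1 (⟨u, hu⟩ : Fin T).castSucc) *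
          (∏ l ∈ Finset.Ico ⟨u, hu⟩ t, z.step P l) /
            d (z.1 t.castSucc) (z.2.1 t) (z.2.2 t)| ≤ (Fintype.card S : ℝ) ^ u * ε := by
  induction u generalizing z with
  | zero =>
    have hI : Finset.Ico (⟨0, hu⟩ : Fin T) t = Finset.Iio t := by
      ext l; simp [Fin.le_def]
    rw [hI, pow_zero, one_mul]
    exact H z hz fun l hl => hzp l (Nat.zero_le _) hl
  | succ u ih =>
    have huT : u < T := Nat.lt_of_succ_lt hu
    set v : Fin T := ⟨u, huT⟩ with hv
    have hvt : v < t := Fin.lt_def.2 hut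
    have hIco : Finset.Ico v t = insert v (Finset.Ico ⟨u + 1, hu⟩ t) := by
      ext l
      simp only [Finset.mem_Ico, Finset.mem_insert, Fin.le_def, Fin.lt_def, Fin.ext_iff, hv]
      omega
    have hprod : ∀ (f : S → A₁ → A₂ → S → ℝ) s a b,
        ∏ l ∈ Finset.Ico v t, (z.update v s a b).step f l =
          f s a b (z.1 (⟨u + 1, hu⟩ : Fin T).castSucc) *
            ∏ l ∈ Finset.Ico ⟨u + 1, hu⟩ t, z.step f l := by
      intro f s a b
      rw [hIco, Finset.prod_insert (by simp [hv, Fin.le_def]), z.step_update_same f s a b]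
      congr 1
      refine Finset.prod_congr rfl fun l hl => ?_
      have := Fin.le_def.1 (Finset.mem_Ico.1 hl).1
      refine z.step_update_of_ne f s a b (fun h => ?_) ?_
      · rw [h] at this; simp [hv] at this
      · simp only [hv] at this ⊢; omega
    have hstep : ∀ s a b, 0 < π.prob u s a b →
        |stateMarginal ι' P' π.prob u s * (P' s a b (z.1 (⟨u + 1, hu⟩ : Fin T).castSucc) *
            ∏ l ∈ Finset.Ico ⟨u + 1, hu⟩ t, z.step P' l) /
            d' (z.1 t.castSucc) (z.2.1 t) (z.2.2 t) -
          stateMarginal ι P π.prob u s * (P s a b (z.1 (⟨u + 1, hu⟩ : Fin T).castSucc) *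
            ∏ l ∈ Finset.Ico ⟨u + 1, hu⟩ t, z.step P l) /
            d (z.1 t.castSucc) (z.2.1 t) (z.2.2 t)| ≤ (Fintype.card S : ℝ) ^ u * ε := by
      intro s a b hπ
      have h := ih huT (Nat.le_of_succ_le hut) (z.update v s a b)
        (by rwa [Path.update_castSucc_of_ne _ _ _ _ hvt.ne', Path.update_act₁_of_ne _ _ _ _ hvt.ne',
              Path.update_act₂_of_ne _ _ _ _ hvt.ne'])
        (by
          intro l hl hlt
          rcases (Fin.le_def.2 hl : v ≤ l).eq_or_lt with rfl | hvl
          · simpa using hov _ _ _ _ hπ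
          · rw [Path.update_castSucc_of_ne _ _ _ _ hvl.ne', Path.update_act₁_of_ne _ _ _ _ hvl.ne',
              Path.update_act₂_of_ne _ _ _ _ hvl.ne']
            exact hzp l (Fin.lt_def.1 hvl) hlt)
      rwa [← hv, hprod, hprod, Path.update_fst_same, Path.update_castSucc_of_ne _ _ _ _ hvt.ne',
        Path.update_act₁_of_ne _ _ _ _ hvt.ne', Path.update_act₂_of_ne _ _ _ _ hvt.ne'] at h
    have hsum := π.abs_sum_prob_mul_le huT _ hstep
    rw [pow_succ', mul_assoc]
    refine le_of_eq_of_le (congrArg _ ?_) hsum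
    simp only [stateMarginal, Finset.sum_mul, Finset.sum_div, ← Finset.sum_sub_distrib]
    exact Finset.sum_congr rfl fun s _ => Finset.sum_congr rfl fun a _ =>
      Finset.sum_congr rfl fun b _ => by ring

/-- The uniform error of a density ratio at the triples where the ratios of products of transition
probabilities to the density in the denominator are estimated well. -/
theorem abs_marginal_div_sub_le {ι ι' : S → ℝ} {P P' : S → A₁ → A₂ → S → ℝ}
    {πb π : Profile T S A₁ A₂} (hov : ∀ t s a b, 0 < π.prob t s a b → 0 < πb.prob t s a b)
    {t : Fin T} {good : S → A₁ → A₂ → Prop} {d d' : S → A₁ → A₂ → ℝ} {ε : ℝ} (hε : 0 ≤ ε)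
    (H : ∀ z : Path T S A₁ A₂, good (z.1 t.castSucc) (z.2.1 t) (z.2.2 t) →
      (∀ l : Fin T, l < t → 0 < πb.prob l (z.1 l.castSucc) (z.2.1 l) (z.2.2 l)) →
      |ι' (z.1 0) * (∏ l ∈ Finset.Iio t, z.step P' l) /
            d' (z.1 t.castSucc) (z.2.1 t) (z.2.2 t) -
          ι (z.1 0) * (∏ l ∈ Finset.Iio t, z.step P l) /
            d (z.1 t.castSucc) (z.2.1 t) (z.2.2 t)| ≤ ε)
    (s : S) (a : A₁) (b : A₂) (hs : good s a b) :
    |marginal ι' P' π t s a b / d' s a b - marginal ι P π t s a b / d s a b| ≤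
      (1 + Fintype.card S : ℝ) ^ T * ε := by
  have h := abs_stateMarginal_mul_prod_sub_le hov H t t.2 le_rfl
    (fun _ => s, fun _ => a, fun _ => b) hs
    (fun l h1 h2 => absurd (Fin.lt_def.1 h2) (not_lt.2 h1))
  simp only [Fin.eta, Finset.Ico_self, Finset.prod_empty, mul_one] at h
  have hc : (0 : ℝ) ≤ Fintype.card S := Nat.cast_nonneg _
  rw [marginal_eq, marginal_eq, mul_div_assoc, mul_div_assoc, ← mul_sub, abs_mul,
    abs_of_nonneg (π.prob_nonneg _ _ _ _)]
  refine (mul_le_of_le_one_left (abs_nonneg _) (π.prob_le_one _ _ _ _)).trans (h.trans ?_)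
  refine mul_le_mul_of_nonneg_right ?_ hε
  calc (Fintype.card S : ℝ) ^ (t : ℕ) ≤ (1 + Fintype.card S : ℝ) ^ (t : ℕ) :=
        pow_le_pow_left₀ hc (by linarith) _
    _ ≤ (1 + Fintype.card S : ℝ) ^ T := pow_le_pow_right₀ (by linarith) t.2.le

end Nuisance

/-! ### Scores in a Markov game -/

section ScoreCoeff

variable {T : ℕ} {S A₁ A₂ : Type*}

/-- Coefficients of a score as an affine function of the rewards along a path: the constant term
is indexed by `none`, the coefficient of the reward at step `t` by `some t`. -/
noncomputable def scoreCoeff (γ : ℝ) (μ Q : Fin T → S → A₁ → A₂ → ℝ) (V : Fin T → S → ℝ)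
    (z : Path T S A₁ A₂) : Option (Fin T) → ℝ
  | none => score γ μ Q V (z, 0)
  | some t => γ ^ (t : ℕ) * μ t (z.1 t.castSucc) (z.2.1 t) (z.2.2 t)

/-- The monomials that `scoreCoeff` refers to: the constant `1` and the reward at a step. -/
def rewardTerm (r : Fin T → ℝ) : Option (Fin T) → ℝ
  | none => 1
  | some t => r t

theorem score_eq_sum (γ : ℝ) (μ Q : Fin T → S → A₁ → A₂ → ℝ) (V : Fin T → S → ℝ)
    (z : Path T S A₁ A₂) (r : Fin T → ℝ) :
    score γ μ Q V (z, r) = ∑ j, scoreCoeff γ μ Q V z j * rewardTerm r j := by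
  rw [Fintype.sum_option]
  simp only [scoreCoeff, rewardTerm, mul_one, score, ← Finset.sum_add_distrib]
  exact Finset.sum_congr rfl fun t _ => by simp only [Pi.zero_apply]; ring

theorem abs_scoreCoeff_le {γ : ℝ} (hγ0 : 0 ≤ γ) (hγ1 : γ ≤ 1)
    {μ Q : Fin T → S → A₁ → A₂ → ℝ} {V : Fin T → S → ℝ} {z : Path T S A₁ A₂} {B q : ℝ}
    (hB : 1 ≤ B) (hq : 0 ≤ q)
    (hμ : ∀ t : Fin T, |μ t (z.1 t.castSucc) (z.2.1 t) (z.2.2 t)| ≤ B)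
    (hQ : ∀ t : Fin T, |Q t (z.1 t.castSucc) (z.2.1 t) (z.2.2 t)| ≤ q)
    (hV : ∀ t : Fin T, |V t (z.1 t.castSucc)| ≤ q) (j : Option (Fin T)) :
    |scoreCoeff γ μ Q V z j| ≤ B * (1 + T * (2 * q)) := by
  have hB0 : 0 ≤ B := zero_le_one.trans hB
  have hT : (0 : ℝ) ≤ T * (2 * q) := by positivity
  cases j with
  | none =>
    simp only [scoreCoeff, score]
    calc _ ≤ ∑ _t : Fin T, B * (2 * q) := by
          refine (Finset.abs_sum_le_sum_abs _ _).trans (Finset.sum_le_sum fun t _ => ?_)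
          rw [abs_mul, abs_of_nonneg (pow_nonneg hγ0 _)]
          refine (mul_le_of_le_one_left (abs_nonneg _) (pow_le_one₀ hγ0 hγ1)).trans ?_
          refine (abs_add_le _ _).trans ?_
          rw [two_mul, mul_add]
          refine add_le_add ?_ ?_
          · rw [abs_mul]
            refine mul_le_mul (hμ t) ?_ (abs_nonneg _) hB0
            simpa using hQ t
          · rw [abs_mul]
            refine mul_le_mul ?_ (hV t) (abs_nonneg _) hB0
            split_ifs
            · simpa using hB
            · exact hμ _
      _ = B * (T * (2 * q)) := by simp; ring
      _ ≤ B * (1 + T * (2 * q)) := mul_le_mul_of_nonneg_left (by linarith) hB0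
  | some t =>
    simp only [scoreCoeff]
    rw [abs_mul, abs_of_nonneg (pow_nonneg hγ0 _)]
    calc _ ≤ B := (mul_le_of_le_one_left (abs_nonneg _) (pow_le_one₀ hγ0 hγ1)).trans (hμ t)
      _ ≤ B * (1 + T * (2 * q)) := le_mul_of_one_le_right hB0 (by linarith)

end ScoreCoeff

section GameScore

variable {T : ℕ} {S A₁ A₂ : Type*} [Fintype S] [Fintype A₁] [Fintype A₂]

namespace Game

variable (G : Game S A₁ A₂)

/-- The mean rewards at the steps of a path. -/
noncomputable def meanRewards (z : Path T S A₁ A₂) (t : Fin T) : ℝ :=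
  G.meanReward (z.1 t.castSucc) (z.2.1 t) (z.2.2 t)

theorem occupancy_eq (π : Profile T S A₁ A₂) (t : ℕ) (s : S) (a : A₁) (b : A₂) :
    G.occupancy π t s a b = π.prob t s a b * stateMarginal G.init.1 G.transFn π.prob t s :=
  marginal_eq _ _ _ _ _ _ _

theorem transFn_nonneg (s : S) (a : A₁) (b : A₂) (s' : S) : 0 ≤ G.transFn s a b s' :=
  (G.trans s a b).2.1 s'

theorem sum_transFn (s : S) (a : A₁) (b : A₂) : ∑ s', G.transFn s a b s' = 1 :=
  (G.trans s a b).2.2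

theorem stateMarginal_nonneg (π : Profile T S A₁ A₂) (t : ℕ) (s : S) :
    0 ≤ stateMarginal G.init.1 G.transFn π.prob t s :=
  TZMG.stateMarginal_nonneg G.init.2.1 G.transFn_nonneg π.prob_nonneg t s

theorem pathWeight_nonneg (π : Profile T S A₁ A₂) (z : Path T S A₁ A₂) : 0 ≤ G.pathWeight π z :=
  mul_nonneg (G.init.2.1 _) (Finset.prod_nonneg fun _ _ =>
    mul_nonneg (π.prob_nonneg _ _ _ _) (G.transFn_nonneg _ _ _ _))

theorem sum_pathWeight (π : Profile T S A₁ A₂) : ∑ z, G.pathWeight π z = 1 := by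
  have h := sum_weight_last G.init.1 G.transFn π.prob T (fun _ => 1)
  simp only [mul_one] at h
  exact h.trans (sum_stateMarginal G.init.2.2 G.sum_transFn π.sum_prob)

/-- A path of positive probability visits only triples of positive occupancy. -/
theorem occupancy_pos_of_pathWeight_pos (π : Profile T S A₁ A₂) {z : Path T S A₁ A₂}
    (hz : 0 < G.pathWeight π z) (t : Fin T) :
    0 < G.occupancy π t (z.1 t.castSucc) (z.2.1 t) (z.2.2 t) := by
  classical
  rw [occupancy_eq]
  refine lt_of_le_of_ne (mul_nonneg (π.prob_nonneg _ _ _ _) (G.stateMarginal_nonneg _ _ _))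
    fun h0 => ?_
  let f : S → A₁ → A₂ → S → ℝ := fun s a b _ =>
    if s = z.1 t.castSucc ∧ a = z.2.1 t ∧ b = z.2.2 t then 1 else 0
  have h := sum_weight_step (init := G.init.1) G.sum_transFn π.sum_prob t f
  have hR : ∀ s a b s', π.prob t s a b * stateMarginal G.init.1 G.transFn π.prob t s *
      G.transFn s a b s' * f s a b s' = 0 := by
    intro s a b s'
    by_cases hs : s = z.1 t.castSucc ∧ a = z.2.1 t ∧ b = z.2.2 t
    · obtain ⟨rfl, rfl, rfl⟩ := hs
      rw [← h0]; ring
    · simp [f, hs]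
  simp only [hR, Finset.sum_const_zero] at h
  have hle := Finset.single_le_sum (f := fun z' : Path T S A₁ A₂ =>
    weight G.init.1 G.transFn π.prob T z' *
      f (z'.1 t.castSucc) (z'.2.1 t) (z'.2.2 t) (z'.1 t.succ))
    (fun z' _ => mul_nonneg (G.pathWeight_nonneg π z') (by simp only [f]; split_ifs <;> norm_num))
    (Finset.mem_univ z)
  rw [h] at hle
  simp only [f, and_self, if_true, mul_one] at hle
  exact absurd hz (not_lt.2 hle)

/-- The discounted value of `π` as a sum over steps and state-action triples. -/
noncomputable def stepValue (π : Profile T S A₁ A₂) : ℝ :=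
  ∑ t ∈ Finset.range T, G.γ ^ t *
    ∑ s, ∑ a, ∑ b, (π.prob t s a b * stateMarginal G.init.1 G.transFn π.prob t s) *
      G.meanReward s a b

theorem sum_pathWeight_mul_meanRewards (π : Profile T S A₁ A₂) :
    ∑ z : Path T S A₁ A₂, G.pathWeight π z * ∑ t : Fin T, G.γ ^ (t : ℕ) * G.meanRewards z t =
      G.stepValue π := by
  rw [stepValue, ← Fin.sum_univ_eq_sum_range (fun t => G.γ ^ t *
    ∑ s, ∑ a, ∑ b, (π.prob t s a b * stateMarginal G.init.1 G.transFn π.prob t s) *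
      G.meanReward s a b)]
  simp only [Finset.mul_sum]
  rw [Finset.sum_comm]
  refine Finset.sum_congr rfl fun t _ => ?_
  simp only [mul_left_comm (G.pathWeight π _), ← Finset.mul_sum]
  congr 1
  have h := sum_weight_step (init := G.init.1) G.sum_transFn π.sum_prob t
    (fun s a b _ => G.meanReward s a b)
  refine h.trans ?_
  simp only [← Finset.sum_mul, ← Finset.mul_sum, G.sum_transFn, mul_one]

/-- The expected score with estimated nuisance functions differs from the value of `π` by at most
a constant times the product of the two estimation errors. -/
theorem abs_sum_pathWeight_score_sub_le {πb π : Profile T S A₁ A₂}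
    (hov : ∀ t s a b, 0 < π.prob t s a b → 0 < πb.prob t s a b)
    (M : ModelEstimate T S A₁ A₂) {ε₁ ε₂ : ℝ} (hε₁ : 0 ≤ ε₁) (hε₂ : 0 ≤ ε₂)
    (H₁ : ∀ t t' : Fin T, t ≤ t' → ∀ z : Path T S A₁ A₂,
      0 < G.occupancy πb t (z.1 t.castSucc) (z.2.1 t) (z.2.2 t) →
      (∀ l : Fin T, t < l → l ≤ t' → 0 < πb.prob l (z.1 l.castSucc) (z.2.1 l) (z.2.2 l)) →
      |M.reward (z.1 t'.castSucc) (z.2.1 t') (z.2.2 t') * ∏ l ∈ Finset.Ico t t', z.step M.trans l -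
        G.meanReward (z.1 t'.castSucc) (z.2.1 t') (z.2.2 t') *
          ∏ l ∈ Finset.Ico t t', z.step G.transFn l| ≤ ε₁)
    (H₂ : ∀ t : Fin T, ∀ z : Path T S A₁ A₂,
      0 < G.occupancy πb t (z.1 t.castSucc) (z.2.1 t) (z.2.2 t) →
      (∀ l : Fin T, l < t → 0 < πb.prob l (z.1 l.castSucc) (z.2.1 l) (z.2.2 l)) →
      |M.init (z.1 0) * (∏ l ∈ Finset.Iio t, z.step M.trans l) /
            M.behav t (z.1 t.castSucc) (z.2.1 t) (z.2.2 t) -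
          G.init.1 (z.1 0) * (∏ l ∈ Finset.Iio t, z.step G.transFn l) /
            G.occupancy πb t (z.1 t.castSucc) (z.2.1 t) (z.2.2 t)| ≤ ε₂) :
    |∑ z, G.pathWeight πb z * score G.γ (M.densityRatio π) (M.actionValue G.γ π)
        (M.stateValue G.γ π) (z, G.meanRewards z) - G.stepValue π| ≤
      T * (2 * (((1 + Fintype.card S : ℝ) ^ T * ε₁) * ((1 + Fintype.card S : ℝ) ^ T * ε₂))) := by
  let μ : ℕ → S → A₁ → A₂ → ℝ := fun t s a b =>
    if h : t < T then M.densityRatio π ⟨t, h⟩ s a b else 0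
  have hμ : M.densityRatio π = fun t : Fin T => μ t := by
    funext t s a b; simp [μ]
  have hc : (0 : ℝ) ≤ (1 + Fintype.card S : ℝ) ^ T :=
    pow_nonneg (by linarith [(Nat.cast_nonneg (Fintype.card S) : (0 : ℝ) ≤ _)]) _
  have hmean := sum_weight_score (init := G.init.1) G.γ G.meanReward G.sum_transFn πb.sum_prob μ
    (fun t => TZMG.actionValue G.γ M.reward M.trans π t)
    (fun t s => ∑ a, ∑ b, π.prob t s a b * TZMG.actionValue G.γ M.reward M.trans π t s a b)
  rw [hμ]
  have hzero : ∀ t s a b, πb.prob t s a b = 0 → π.prob t s a b = 0 := fun t s a b h =>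
    le_antisymm (not_lt.1 fun h' => (hov t s a b h').ne' h) (π.prob_nonneg t s a b)
  have hbias := abs_bias_le (T := T) G.γ_nonneg G.γ_le_one (R := G.meanReward) G.init.2.1
    G.init.2.2 G.transFn_nonneg G.sum_transFn πb.prob_nonneg πb.sum_prob π.prob_nonneg π.sum_prob
    (fun t _ => hzero t)
    (fun t s a b => πb.prob t s a b * stateMarginal G.init.1 G.transFn πb.prob t s * μ t s a b)
    (fun t => TZMG.actionValue G.γ M.reward M.trans π t)
    (fun t => TZMG.actionValue G.γ G.meanReward G.transFn π t)
    (fun t s => ∑ a, ∑ b, π.prob t s a b * TZMG.actionValue G.γ M.reward M.trans π t s a b)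
    (TZMG.stateValue G.γ G.meanReward G.transFn π) (fun _ _ _ => rfl)
    (fun t ht s => stateValue_eq _ _ _ _ ht s) (fun _ _ _ _ _ => rfl)
    (stateValue_horizon _ _ _ _) (mul_nonneg hc hε₂)
    (ξ₁ := (1 + Fintype.card S : ℝ) ^ T * ε₁)
    (by
      intro t ht s a b hpos
      rw [← G.occupancy_eq] at hpos
      rw [abs_sub_comm]
      exact abs_actionValue_sub_le (R := G.meanReward) (P := G.transFn) G.γ_nonneg G.γ_le_one hov
        (t := ⟨t, ht⟩) (good := fun s a b => 0 < G.occupancy πb t s a b) hε₁ (H₁ ⟨t, ht⟩) s a b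
        hpos)
    (by
      intro t ht s a b
      rw [← G.occupancy_eq, ← G.occupancy_eq]
      have hocc : 0 ≤ G.occupancy πb t s a b := by
        rw [occupancy_eq]
        exact mul_nonneg (πb.prob_nonneg _ _ _ _) (G.stateMarginal_nonneg _ _ _)
      rcases hocc.eq_or_lt' with h0 | hpos
      · have h : G.occupancy π t s a b = 0 := by
          rw [occupancy_eq, mul_eq_zero] at h0 ⊢
          exact h0.imp (hzero t s a b) (stateMarginal_eq_zero G.init.2.1 G.transFn_nonneg
            πb.prob_nonneg hzero t s)
        simp [h0, h]
      · have h := abs_marginal_div_sub_le (ι := G.init.1) (P := G.transFn) hov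
          (t := ⟨t, ht⟩) (d := G.occupancy πb t) (d' := M.behav ⟨t, ht⟩)
          (good := fun s a b => 0 < G.occupancy πb t s a b) hε₂ (H₂ ⟨t, ht⟩) s a b hpos
        have e : G.occupancy πb t s a b * μ t s a b - G.occupancy π t s a b =
            G.occupancy πb t s a b * (marginal M.init M.trans π t s a b / M.behav ⟨t, ht⟩ s a b -
              marginal G.init.1 G.transFn π t s a b / G.occupancy πb t s a b) := by
          simp only [μ, dif_pos ht, ModelEstimate.densityRatio]
          rw [mul_sub, mul_div_cancel₀ _ hpos.ne']
          rfl
        rw [e, abs_mul, abs_of_pos hpos]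
        exact mul_le_mul_of_nonneg_left h hpos.le)
  rw [← hmean] at hbias
  exact hbias

end Game

end GameScore

/-! ### The law of a trajectory -/

section Law

variable {T : ℕ} {S A₁ A₂ : Type*} [Fintype S]

namespace Game

variable (G : Game S A₁ A₂)

/-- The joint law of the rewards along a given path. -/
noncomputable def rewardsLaw (z : Path T S A₁ A₂) : Measure (Fin T → ℝ) :=
  Measure.pi fun t : Fin T =>
    (G.rewardLaw (z.1 t.castSucc) (z.2.1 t) (z.2.2 t) : Measure ℝ)

instance (z : Path T S A₁ A₂) : IsProbabilityMeasure (G.rewardsLaw z) := by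
  unfold rewardsLaw; infer_instance

theorem measurePreserving_eval_rewardsLaw (z : Path T S A₁ A₂) (t : Fin T) :
    MeasurePreserving (Function.eval t) (G.rewardsLaw z)
      (G.rewardLaw (z.1 t.castSucc) (z.2.1 t) (z.2.2 t) : Measure ℝ) :=
  measurePreserving_eval (fun t : Fin T =>
    (G.rewardLaw (z.1 t.castSucc) (z.2.1 t) (z.2.2 t) : Measure ℝ)) t

theorem integral_reward (z : Path T S A₁ A₂) (t : Fin T) :
    ∫ r, r t ∂(G.rewardsLaw z) = G.meanRewards z t := by
  have h := G.measurePreserving_eval_rewardsLaw z t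
  rw [meanRewards, meanReward, ← h.map_eq]
  exact (integral_map (f := fun r : ℝ => r) h.measurable.aemeasurable
    measurable_id.aestronglyMeasurable).symm

theorem ae_abs_reward_le {Rmax : ℝ}
    (hreward : ∀ s a₁ a₂, ∀ᵐ r ∂(G.rewardLaw s a₁ a₂ : Measure ℝ), |r| ≤ Rmax)
    (z : Path T S A₁ A₂) :
    ∀ᵐ r ∂(G.rewardsLaw z), ∀ t, |r t| ≤ Rmax :=
  ae_all_iff.2 fun t => (G.measurePreserving_eval_rewardsLaw z t).quasiMeasurePreserving.ae
    (hreward _ _ _)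

theorem integrable_reward {Rmax : ℝ}
    (hreward : ∀ s a₁ a₂, ∀ᵐ r ∂(G.rewardLaw s a₁ a₂ : Measure ℝ), |r| ≤ Rmax)
    (z : Path T S A₁ A₂) (t : Fin T) :
    Integrable (fun r : Fin T → ℝ => r t) (G.rewardsLaw z) :=
  Integrable.of_bound (measurable_pi_apply t).aestronglyMeasurable Rmax
    ((G.ae_abs_reward_le hreward z).mono fun _ h => h t)

theorem abs_meanReward_le {Rmax : ℝ}
    (hreward : ∀ s a₁ a₂, ∀ᵐ r ∂(G.rewardLaw s a₁ a₂ : Measure ℝ), |r| ≤ Rmax)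
    (s : S) (a : A₁) (b : A₂) : |G.meanReward s a b| ≤ Rmax := by
  have h := norm_integral_le_of_norm_le_const (f := fun r : ℝ => r) (hreward s a b)
  simpa [meanReward] using h

variable [Fintype A₁] [Fintype A₂] [MeasurableSpace S] [MeasurableSingletonClass S]
  [MeasurableSpace A₁] [MeasurableSingletonClass A₁]
  [MeasurableSpace A₂] [MeasurableSingletonClass A₂]

theorem trajLaw_eq (π : Profile T S A₁ A₂) : G.trajLaw π = ∑ z : Path T S A₁ A₂,
    ENNReal.ofReal (G.pathWeight π z) • Measure.map (Prod.mk z) (G.rewardsLaw z) := by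
  rw [trajLaw, Measure.sum_fintype]
  rfl

theorem ae_trajLaw (π : Profile T S A₁ A₂) {p : Traj T S A₁ A₂ → Prop}
    (h : ∀ z, 0 < G.pathWeight π z → ∀ᵐ r ∂(G.rewardsLaw z), p (z, r)) :
    ∀ᵐ x ∂(G.trajLaw π), p x := by
  rw [trajLaw, Measure.ae_sum_iff]
  intro z
  rcases (G.pathWeight_nonneg π z).eq_or_lt' with h0 | hz
  · simp [h0]
  · exact Measure.ae_smul_measure ((measurableEmbedding_prodMk_left z).ae_map_iff.2 (h z hz)) _

theorem integral_trajLaw (π : Profile T S A₁ A₂) {f : Traj T S A₁ A₂ → ℝ}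
    (hf : ∀ z, Integrable (fun r => f (z, r)) (G.rewardsLaw z)) :
    ∫ x, f x ∂(G.trajLaw π) = ∑ z, G.pathWeight π z * ∫ r, f (z, r) ∂(G.rewardsLaw z) := by
  rw [trajLaw_eq, integral_finsetSum_measure]
  · refine Finset.sum_congr rfl fun z _ => ?_
    rw [integral_smul_measure, ENNReal.toReal_ofReal (G.pathWeight_nonneg π z),
      (measurableEmbedding_prodMk_left z).integral_map]
    rfl
  · intro z _
    exact ((measurableEmbedding_prodMk_left z).integrable_map_iff.2 (hf z)).smul_measure
      ENNReal.ofReal_ne_top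

instance (π : Profile T S A₁ A₂) : IsProbabilityMeasure (G.trajLaw π) := by
  refine ⟨?_⟩
  have h1 : ∀ z : Path T S A₁ A₂, Measure.map (Prod.mk z) (G.rewardsLaw z) Set.univ = 1 := by
    intro z
    rw [Measure.map_apply measurable_prodMk_left MeasurableSet.univ]
    simp
  rw [trajLaw_eq]
  simp only [Measure.coe_finsetSum, Finset.sum_apply, Measure.smul_apply, h1, smul_eq_mul, mul_one]
  rw [← ENNReal.ofReal_sum_of_nonneg fun z _ => G.pathWeight_nonneg π z, sum_pathWeight,
    ENNReal.ofReal_one]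

instance (π : Profile T S A₁ A₂) (n : ℕ) : IsProbabilityMeasure (G.dataLaw π n) := by
  unfold dataLaw; infer_instance

/-- Almost surely, all trajectories of the data have a path of positive probability. -/
theorem ae_dataLaw_pathWeight_pos (π : Profile T S A₁ A₂) (n : ℕ) :
    ∀ᵐ D ∂(G.dataLaw π n), ∀ i, 0 < G.pathWeight π (D i).1 :=
  ae_all_iff.2 fun i => (Measure.quasiMeasurePreserving_eval (fun _ => G.trajLaw π) i).ae
    (p := fun x => 0 < G.pathWeight π x.1) (G.ae_trajLaw π fun _ hz => ae_of_all _ fun _ => hz)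

theorem value_eq_stepValue {Rmax : ℝ}
    (hreward : ∀ s a₁ a₂, ∀ᵐ r ∂(G.rewardLaw s a₁ a₂ : Measure ℝ), |r| ≤ Rmax)
    (π : Profile T S A₁ A₂) : G.value π = G.stepValue π := by
  have hint : ∀ (z : Path T S A₁ A₂) (t : Fin T),
      Integrable (fun r : Fin T → ℝ => G.γ ^ (t : ℕ) * r t) (G.rewardsLaw z) :=
    fun z t => (G.integrable_reward hreward z t).const_mul _
  rw [value, integral_trajLaw, ← sum_pathWeight_mul_meanRewards]
  · refine Finset.sum_congr rfl fun z _ => ?_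
    simp only
    rw [integral_finsetSum _ fun t _ => hint z t]
    simp only [integral_const_mul, integral_reward]
  · exact fun z => integrable_finsetSum _ fun t _ => hint z t

theorem abs_value_le {Rmax : ℝ}
    (hreward : ∀ s a₁ a₂, ∀ᵐ r ∂(G.rewardLaw s a₁ a₂ : Measure ℝ), |r| ≤ Rmax)
    (π : Profile T S A₁ A₂) : |G.value π| ≤ T * Rmax := by
  rw [G.value_eq_stepValue hreward, ← sum_pathWeight_mul_meanRewards]
  calc _ ≤ ∑ z : Path T S A₁ A₂, G.pathWeight π z * (T * Rmax) := by
        refine (Finset.abs_sum_le_sum_abs _ _).trans (Finset.sum_le_sum fun z _ => ?_)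
        rw [abs_mul, abs_of_nonneg (G.pathWeight_nonneg π z)]
        refine mul_le_mul_of_nonneg_left ?_ (G.pathWeight_nonneg π z)
        calc _ ≤ ∑ _t : Fin T, Rmax := by
              refine (Finset.abs_sum_le_sum_abs _ _).trans (Finset.sum_le_sum fun t _ => ?_)
              rw [abs_mul, abs_of_nonneg (pow_nonneg G.γ_nonneg _)]
              exact (mul_le_of_le_one_left (abs_nonneg _)
                (pow_le_one₀ G.γ_nonneg G.γ_le_one)).trans (G.abs_meanReward_le hreward _ _ _)
          _ = T * Rmax := by simp
    _ = T * Rmax := by rw [← Finset.sum_mul, sum_pathWeight, one_mul]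

open Classical in
/-- The function of a trajectory that is a monomial of the rewards on the event of a given path,
and `0` otherwise. Every score is a linear combination of these finitely many functions. -/
noncomputable def pathTerm (c : Path T S A₁ A₂ × Option (Fin T)) (x : Traj T S A₁ A₂) : ℝ :=
  if x.1 = c.1 then rewardTerm x.2 c.2 else 0

theorem measurable_pathTerm (c : Path T S A₁ A₂ × Option (Fin T)) :
    Measurable (pathTerm c : Traj T S A₁ A₂ → ℝ) := by
  unfold pathTerm
  refine Measurable.ite (measurable_fst (measurableSet_singleton c.1)) ?_ measurable_const
  rcases c with ⟨z, _ | t⟩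
  · exact measurable_const
  · exact (measurable_pi_apply t).comp measurable_snd

theorem ae_abs_pathTerm_le {Rmax : ℝ}
    (hreward : ∀ s a₁ a₂, ∀ᵐ r ∂(G.rewardLaw s a₁ a₂ : Measure ℝ), |r| ≤ Rmax)
    (π : Profile T S A₁ A₂) (c : Path T S A₁ A₂ × Option (Fin T)) :
    ∀ᵐ x ∂(G.trajLaw π), |pathTerm c x| ≤ max 1 Rmax := by
  refine G.ae_trajLaw π fun z _ => (G.ae_abs_reward_le hreward z).mono fun r hr => ?_
  unfold pathTerm
  split_ifs
  · rcases c with ⟨z, _ | t⟩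
    · simp [rewardTerm]
    · exact (hr t).trans (le_max_right _ _)
  · simp

theorem integral_pathTerm {Rmax : ℝ}
    (hreward : ∀ s a₁ a₂, ∀ᵐ r ∂(G.rewardLaw s a₁ a₂ : Measure ℝ), |r| ≤ Rmax)
    (π : Profile T S A₁ A₂) (c : Path T S A₁ A₂ × Option (Fin T)) :
    ∫ x, pathTerm c x ∂(G.trajLaw π) =
      G.pathWeight π c.1 * rewardTerm (G.meanRewards c.1) c.2 := by
  classical
  have hint : ∀ z : Path T S A₁ A₂, Integrable (fun r => rewardTerm r c.2) (G.rewardsLaw z) := by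
    intro z
    rcases c with ⟨z', _ | t⟩
    · exact integrable_const _
    · exact G.integrable_reward hreward z t
  have hmean : ∫ r, rewardTerm r c.2 ∂(G.rewardsLaw c.1) =
      rewardTerm (G.meanRewards c.1) c.2 := by
    rcases c with ⟨z', _ | t⟩
    · simp [rewardTerm]
    · exact G.integral_reward z' t
  rw [integral_trajLaw, Finset.sum_eq_single c.1]
  · simp only [pathTerm, if_true, hmean]
  · intro z _ hz
    simp [pathTerm, hz]
  · exact fun h => absurd (Finset.mem_univ _) h
  · intro z
    by_cases hz : z = c.1
    · simpa [pathTerm, hz] using hint c.1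
    · simp [pathTerm, hz]

end Game

theorem score_eq_sum_pathTerm [Fintype A₁] [Fintype A₂] (γ : ℝ) (μ Q : Fin T → S → A₁ → A₂ → ℝ)
    (V : Fin T → S → ℝ) (x : Traj T S A₁ A₂) :
    score γ μ Q V x = ∑ c : Path T S A₁ A₂ × Option (Fin T),
      scoreCoeff γ μ Q V c.1 c.2 * Game.pathTerm c x := by
  classical
  rw [Fintype.sum_prod_type, Finset.sum_eq_single x.1]
  · simp only [Game.pathTerm, if_true]
    exact score_eq_sum γ μ Q V x.1 x.2
  · intro z _ hz
    simp [Game.pathTerm, hz.symm]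
  · exact fun h => absurd (Finset.mem_univ _) h

end Law

/-! ### Concentration -/

section Concentration

open ProbabilityTheory

/-- **Hoeffding's inequality** for the deviation of a partial sum of a bounded function of
independent observations; the exponent refers to the full sample size. -/
theorem measure_abs_sum_sub_ge_le {X : Type*} [MeasurableSpace X] (μ : Measure X)
    [IsProbabilityMeasure μ] {g : X → ℝ} (hg : Measurable g) {B : ℝ} (hB : 0 < B)
    (hbd : ∀ᵐ x ∂μ, |g x| ≤ B) {n : ℕ} (s : Finset (Fin n)) {ε : ℝ} (hε : 0 < ε) :
    (Measure.pi fun _ : Fin n => μ) {D | ε ≤ |∑ i ∈ s, (g (D i) - ∫ x, g x ∂μ)|} ≤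
      ENNReal.ofReal (2 * Real.exp (-ε ^ 2 / (2 * (n * B ^ 2)))) := by
  rcases s.eq_empty_or_nonempty with rfl | hs
  · simp [not_le.2 hε]
  set P := Measure.pi fun _ : Fin n => μ with hP
  set Y : Fin n → (Fin n → X) → ℝ := fun i D => g (D i) - ∫ x, g x ∂μ with hY
  have hsub : HasSubgaussianMGF (fun x => g x - ∫ x, g x ∂μ) ((‖B - -B‖₊ / 2) ^ 2) μ :=
    hasSubgaussianMGF_of_mem_Icc hg.aemeasurable (hbd.mono fun x hx => abs_le.1 hx)
  have hc : (((‖B - -B‖₊ / 2) ^ 2 : NNReal) : ℝ) = B ^ 2 := by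
    push_cast
    rw [Real.norm_eq_abs, show B - -B = 2 * B by ring,
      abs_of_pos (by positivity)]
    ring
  have hsubY : ∀ i, HasSubgaussianMGF (Y i) ((‖B - -B‖₊ / 2) ^ 2) P := by
    intro i
    have h := (measurePreserving_eval (fun _ : Fin n => μ) i)
    have h' : HasSubgaussianMGF (fun x => g x - ∫ x, g x ∂μ) ((‖B - -B‖₊ / 2) ^ 2)
        (P.map (Function.eval i)) := by rw [hP, h.map_eq]; exact hsub
    exact HasSubgaussianMGF.of_map h.measurable.aemeasurable h'
  have hind : iIndepFun Y P :=
    iIndepFun_pi (X := fun _ x => g x - ∫ x, g x ∂μ) fun _ => (hg.sub_const _).aemeasurable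
  have hexp : ∀ Y' : Fin n → (Fin n → X) → ℝ, iIndepFun Y' P →
      (∀ i, HasSubgaussianMGF (Y' i) ((‖B - -B‖₊ / 2) ^ 2) P) →
      P.real {D | ε ≤ ∑ i ∈ s, Y' i D} ≤ Real.exp (-ε ^ 2 / (2 * (n * B ^ 2))) := by
    intro Y' hY' hs'
    refine (HasSubgaussianMGF.measure_sum_ge_le_of_iIndepFun hY' (s := s) (fun i _ => hs' i)
      hε.le).trans (Real.exp_le_exp.2 ?_)
    rw [neg_div, neg_div, neg_le_neg_iff]
    have hcard : (s.card : ℝ) ≤ n := by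
      exact_mod_cast (Finset.card_le_univ s).trans (by simp)
    have hspos : (0 : ℝ) < s.card := by exact_mod_cast hs.card_pos
    rw [Finset.sum_const, nsmul_eq_mul, NNReal.coe_mul, hc, NNReal.coe_natCast]
    gcongr
  have h1 := hexp Y hind hsubY
  have h2 := hexp (fun i D => -Y i D)
    (hind.comp (fun _ y => -y) fun _ => measurable_neg) fun i => (hsubY i).neg
  have hsubset : {D | ε ≤ |∑ i ∈ s, (g (D i) - ∫ x, g x ∂μ)|} ⊆
      {D | ε ≤ ∑ i ∈ s, Y i D} ∪ {D | ε ≤ ∑ i ∈ s, -Y i D} := by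
    intro D hD
    rcases le_abs.1 (show ε ≤ |∑ i ∈ s, (g (D i) - ∫ x, g x ∂μ)| from hD) with h | h
    · exact Or.inl h
    · right; simpa [hY, Finset.sum_neg_distrib] using h
  rw [← ofReal_measureReal]
  refine ENNReal.ofReal_le_ofReal ?_
  calc _ ≤ P.real ({D | ε ≤ ∑ i ∈ s, Y i D} ∪ {D | ε ≤ ∑ i ∈ s, -Y i D}) :=
        measureReal_mono hsubset
    _ ≤ _ := (measureReal_union_le _ _).trans (by linarith)

/-- If a mean square is `o(n ^ (-2 α))`, then the probability of an error above `n ^ (-α)` tends to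
zero. -/
theorem tendsto_measure_abs_gt {X : ℕ → Type*} [∀ n, MeasurableSpace (X n)]
    (P : ∀ n, Measure (X n)) (e : ∀ n, X n → ℝ) (he : ∀ n, Measurable (e n)) (α : ℝ)
    (h : Tendsto (fun n : ℕ => ENNReal.ofReal ((n : ℝ) ^ (2 * α)) *
      ∫⁻ D, ENNReal.ofReal (e n D ^ 2) ∂(P n)) atTop (𝓝 0)) :
    Tendsto (fun n : ℕ => P n {D | (n : ℝ) ^ (-α) < |e n D|}) atTop (𝓝 0) := by
  refine tendsto_of_tendsto_of_tendsto_of_le_of_le' tendsto_const_nhds h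
    (Eventually.of_forall fun _ => zero_le) ((eventually_gt_atTop 0).mono fun n hn => ?_)
  have hn' : (0 : ℝ) < n := Nat.cast_pos.2 hn
  set q : ℝ := (n : ℝ) ^ (-α) with hq
  have hq0 : 0 < q := Real.rpow_pos_of_pos hn' _
  have hmul : (n : ℝ) ^ (2 * α) * q ^ 2 = 1 := by
    rw [hq, ← Real.rpow_natCast, ← Real.rpow_mul hn'.le, ← Real.rpow_add hn']
    norm_num
    rw [show 2 * α + -(α * 2) = 0 by ring, Real.rpow_zero]
  have hmarkov := mul_meas_ge_le_lintegral₀ (μ := P n)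
    (((he n).pow_const 2).ennreal_ofReal.aemeasurable) (ENNReal.ofReal (q ^ 2))
  calc P n {D | q < |e n D|}
      ≤ P n {D | ENNReal.ofReal (q ^ 2) ≤ ENNReal.ofReal (e n D ^ 2)} := by
        refine measure_mono fun D hD => ENNReal.ofReal_le_ofReal ?_
        rw [← sq_abs (e n D)]
        exact pow_le_pow_left₀ hq0.le (le_of_lt hD) 2
    _ = ENNReal.ofReal ((n : ℝ) ^ (2 * α)) * (ENNReal.ofReal (q ^ 2) *
          P n {D | ENNReal.ofReal (q ^ 2) ≤ ENNReal.ofReal (e n D ^ 2)}) := by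
        rw [← mul_assoc, ← ENNReal.ofReal_mul (Real.rpow_nonneg hn'.le _), hmul, ENNReal.ofReal_one,
          one_mul]
    _ ≤ _ := by gcongr

end Concentration

/-! ### The estimator on a good event -/

section GoodEvent

/-- Averages of linear combinations whose coefficients depend on the fold of the observation: the
deviation from `v` splits into the centered sums over the folds and the bias of each fold. -/
theorem abs_average_sub_le {X J : Type*} [Fintype J] {n K : ℕ} (hn : 0 < n) (f : Fin n → Fin K)
    (c : Fin K → J → ℝ) (g : J → X → ℝ) (m : J → ℝ) (D : Fin n → X) {v Λ β : ℝ}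
    (hdev : ∀ k j, |c k j * ∑ i with f i = k, (g j (D i) - m j)| ≤ Λ)
    (hbias : ∀ k, |∑ j, c k j * m j - v| ≤ β) :
    |(1 / (n : ℝ)) * ∑ i, ∑ j, c (f i) j * g j (D i) - v| ≤
      1 / n * ((K * Fintype.card J : ℕ) * Λ) + β := by
  have hn' : (0 : ℝ) < n := Nat.cast_pos.2 hn
  have hsplit : (1 / (n : ℝ)) * ∑ i, ∑ j, c (f i) j * g j (D i) - v =
      1 / n * ∑ k, ∑ j, c k j * ∑ i with f i = k, (g j (D i) - m j) +
        1 / n * ∑ i, (∑ j, c (f i) j * m j - v) := by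
    have h1 : ∑ k, ∑ j, c k j * ∑ i with f i = k, (g j (D i) - m j) =
        ∑ i, ∑ j, c (f i) j * (g j (D i) - m j) := by
      rw [← Finset.sum_fiberwise Finset.univ f]
      refine Finset.sum_congr rfl fun k _ => ?_
      rw [Finset.sum_comm]
      refine Finset.sum_congr rfl fun j _ => ?_
      rw [Finset.mul_sum]
      refine Finset.sum_congr rfl fun i hi => ?_
      rw [(Finset.mem_filter.1 hi).2]
    rw [h1, ← mul_add, ← Finset.sum_add_distrib]
    have h2 : ∀ i, ∑ j, c (f i) j * (g j (D i) - m j) + (∑ j, c (f i) j * m j - v) =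
        ∑ j, c (f i) j * g j (D i) - v := by
      intro i
      simp only [mul_sub, Finset.sum_sub_distrib]
      ring
    simp only [h2, Finset.sum_sub_distrib, Finset.sum_const, Finset.card_univ, Fintype.card_fin,
      nsmul_eq_mul]
    field_simp
  rw [hsplit]
  refine (abs_add_le _ _).trans (add_le_add ?_ ?_)
  · rw [abs_mul, abs_of_pos (by positivity)]
    refine mul_le_mul_of_nonneg_left ?_ (by positivity)
    calc _ ≤ ∑ _k : Fin K, ∑ _j : J, Λ :=
          (Finset.abs_sum_le_sum_abs _ _).trans (Finset.sum_le_sum fun k _ =>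
            (Finset.abs_sum_le_sum_abs _ _).trans (Finset.sum_le_sum fun j _ => hdev k j))
      _ = _ := by simp [mul_assoc]
  · rw [abs_mul, abs_of_pos (by positivity)]
    calc _ ≤ 1 / (n : ℝ) * ∑ _i : Fin n, β :=
          mul_le_mul_of_nonneg_left ((Finset.abs_sum_le_sum_abs _ _).trans
            (Finset.sum_le_sum fun i _ => hbias (f i))) (by positivity)
      _ = β := by
          simp only [Finset.sum_const, Finset.card_univ, Fintype.card_fin, nsmul_eq_mul]
          field_simp

theorem abs_iSup_sub_iSup_le {ι : Type*} [Nonempty ι] {f g : ι → ℝ} {B : ℝ}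
    (hg : BddAbove (Set.range g)) (h : ∀ i, |f i - g i| ≤ B) : |(⨆ i, f i) - ⨆ i, g i| ≤ B := by
  obtain ⟨b, hb⟩ := hg
  have hg' : ∀ i, g i ≤ b := fun i => hb ⟨i, rfl⟩
  have hf : BddAbove (Set.range f) := by
    refine ⟨b + B, ?_⟩
    rintro _ ⟨i, rfl⟩
    linarith [(abs_le.1 (h i)).2, hg' i]
  rw [abs_le]
  constructor
  · have : ⨆ i, g i ≤ (⨆ i, f i) + B := ciSup_le fun i => by
      linarith [(abs_le.1 (h i)).1, le_ciSup hf i]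
    linarith
  · have : ⨆ i, f i ≤ (⨆ i, g i) + B := ciSup_le fun i => by
      linarith [(abs_le.1 (h i)).2, le_ciSup ⟨b, hb⟩ i]
    linarith

variable {T : ℕ} {S A₁ A₂ : Type*} [Fintype S] [Fintype A₁] [Fintype A₂]

/-- The bounds on the estimated nuisance functions of `π` that `CrossFit.Bounded` asserts to hold
almost surely, for a single fitted model. -/
def ModelEstimate.BoundedAt (M : ModelEstimate T S A₁ A₂) (G : Game S A₁ A₂)
    (πb π : Profile T S A₁ A₂) (C Rmax : ℝ) : Prop :=
  ∀ (t : Fin T) (s : S) (a₁ : A₁) (a₂ : A₂), 0 < G.occupancy πb t s a₁ a₂ →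
    0 ≤ M.densityRatio π t s a₁ a₂ ∧ M.densityRatio π t s a₁ a₂ ≤ C ^ ((t : ℕ) + 1) ∧
      |M.actionValue G.γ π t s a₁ a₂| ≤ ((T : ℝ) - (t : ℕ)) * Rmax

/-- A bound for all coefficients of an estimated score. -/
def coeffBound (T : ℕ) (C Rmax : ℝ) : ℝ := max 1 |C| ^ T * (1 + T * (2 * (T * |Rmax|)))

theorem coeffBound_nonneg (T : ℕ) (C Rmax : ℝ) : 0 ≤ coeffBound T C Rmax := by
  unfold coeffBound; positivity

theorem ModelEstimate.BoundedAt.abs_scoreCoeff_le {M : ModelEstimate T S A₁ A₂}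
    {G : Game S A₁ A₂} {πb π : Profile T S A₁ A₂} {C Rmax : ℝ}
    (h : M.BoundedAt G πb π C Rmax)
    (hov : ∀ t s a b, 0 < π.prob t s a b → 0 < πb.prob t s a b) {z : Path T S A₁ A₂}
    (hz : 0 < G.pathWeight πb z) (j : Option (Fin T)) :
    |scoreCoeff G.γ (M.densityRatio π) (M.actionValue G.γ π) (M.stateValue G.γ π) z j| ≤
      coeffBound T C Rmax := by
  have hocc := G.occupancy_pos_of_pathWeight_pos πb hz
  have hC1 : (1 : ℝ) ≤ max 1 |C| := le_max_left _ _
  have hQ : ∀ (t : Fin T) s a b, 0 < G.occupancy πb t s a b →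
      |M.actionValue G.γ π t s a b| ≤ T * |Rmax| := by
    intro t s a b hpos
    refine (h t s a b hpos).2.2.trans ?_
    have ht : (t : ℝ) ≤ T := by exact_mod_cast t.2.le
    calc ((T : ℝ) - (t : ℕ)) * Rmax ≤ ((T : ℝ) - (t : ℕ)) * |Rmax| :=
          mul_le_mul_of_nonneg_left (le_abs_self _) (by linarith)
      _ ≤ T * |Rmax| := mul_le_mul_of_nonneg_right
          (by linarith [(Nat.cast_nonneg (t : ℕ) : (0 : ℝ) ≤ _)]) (abs_nonneg _)
  refine TZMG.abs_scoreCoeff_le G.γ_nonneg G.γ_le_one (one_le_pow₀ hC1) (by positivity) ?_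
    (fun t => hQ t _ _ _ (hocc t)) ?_ j
  · intro t
    obtain ⟨h0, h1, -⟩ := h t _ _ _ (hocc t)
    rw [abs_of_nonneg h0]
    calc _ ≤ C ^ ((t : ℕ) + 1) := h1
      _ ≤ |C| ^ ((t : ℕ) + 1) := by rw [← abs_pow]; exact le_abs_self _
      _ ≤ max 1 |C| ^ ((t : ℕ) + 1) := pow_le_pow_left₀ (abs_nonneg _) (le_max_right _ _) _
      _ ≤ max 1 |C| ^ T := pow_le_pow_right₀ hC1 t.2
  · intro t
    have hm : 0 < stateMarginal G.init.1 G.transFn πb.prob t (z.1 t.castSucc) := by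
      have h1 := hocc t
      rw [G.occupancy_eq] at h1
      exact pos_of_mul_pos_right h1 (πb.prob_nonneg _ _ _ _)
    rw [ModelEstimate.stateValue]
    calc _ ≤ ∑ a, ∑ b, |π.prob t (z.1 t.castSucc) a b *
          M.actionValue G.γ π t (z.1 t.castSucc) a b| :=
          (Finset.abs_sum_le_sum_abs _ _).trans
            (Finset.sum_le_sum fun a _ => Finset.abs_sum_le_sum_abs _ _)
      _ ≤ ∑ a, ∑ b, π.prob t (z.1 t.castSucc) a b * (T * |Rmax|) := by
          refine Finset.sum_le_sum fun a _ => Finset.sum_le_sum fun b _ => ?_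
          rw [abs_mul, abs_of_nonneg (π.prob_nonneg _ _ _ _)]
          rcases (π.prob_nonneg t (z.1 t.castSucc) a b).eq_or_lt' with h0 | hpos
          · simp [h0]
          · refine mul_le_mul_of_nonneg_left (hQ t _ _ _ ?_) hpos.le
            rw [G.occupancy_eq]
            exact mul_pos (hov _ _ _ _ hpos) hm
      _ = T * |Rmax| := by simp only [← Finset.sum_mul, π.sum_prob t t.2, one_mul]

/-- The fitted model estimates products of a mean reward and transition probabilities up to `ε₁`
and the ratios of products of transition probabilities to the behavior density up to `ε₂`, wherever
`CrossFit.RewardTransRate` and `CrossFit.TransDensityRate` control their mean squared errors. -/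
structure ModelEstimate.Accurate (M : ModelEstimate T S A₁ A₂) (G : Game S A₁ A₂)
    (πb : Profile T S A₁ A₂) (ε₁ ε₂ : ℝ) : Prop where
  reward : ∀ t t' : Fin T, t ≤ t' → ∀ z : Path T S A₁ A₂,
    0 < G.occupancy πb t (z.1 t.castSucc) (z.2.1 t) (z.2.2 t) →
    (∀ l : Fin T, t < l → l ≤ t' → 0 < πb.prob l (z.1 l.castSucc) (z.2.1 l) (z.2.2 l)) →
    |M.reward (z.1 t'.castSucc) (z.2.1 t') (z.2.2 t') * ∏ l ∈ Finset.Ico t t', z.step M.trans l -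
      G.meanReward (z.1 t'.castSucc) (z.2.1 t') (z.2.2 t') *
        ∏ l ∈ Finset.Ico t t', z.step G.transFn l| ≤ ε₁
  density : ∀ t : Fin T, ∀ z : Path T S A₁ A₂,
    0 < G.occupancy πb t (z.1 t.castSucc) (z.2.1 t) (z.2.2 t) →
    (∀ l : Fin T, l < t → 0 < πb.prob l (z.1 l.castSucc) (z.2.1 l) (z.2.2 l)) →
    |M.init (z.1 0) * (∏ l ∈ Finset.Iio t, z.step M.trans l) /
          M.behav t (z.1 t.castSucc) (z.2.1 t) (z.2.2 t) -
        G.init.1 (z.1 0) * (∏ l ∈ Finset.Iio t, z.step G.transFn l) /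
          G.occupancy πb t (z.1 t.castSucc) (z.2.1 t) (z.2.2 t)| ≤ ε₂

variable [MeasurableSpace S] [MeasurableSingletonClass S]
  [MeasurableSpace A₁] [MeasurableSingletonClass A₁]
  [MeasurableSpace A₂] [MeasurableSingletonClass A₂]
  {K : ℕ} {fold : (n : ℕ) → Fin n → Fin K}

/-- On data with accurate bounded fits and small deviations of the path terms, the estimated value
of a profile is close to its value. The deviations do not depend on the profile. -/
theorem CrossFit.abs_drlValue_sub_value_le (E : CrossFit T S A₁ A₂ K fold) {G : Game S A₁ A₂}
    {πb π : Profile T S A₁ A₂} (hov : ∀ t s a b, 0 < π.prob t s a b → 0 < πb.prob t s a b)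
    {C Rmax : ℝ} (hreward : ∀ s a₁ a₂, ∀ᵐ r ∂(G.rewardLaw s a₁ a₂ : Measure ℝ), |r| ≤ Rmax)
    {n : ℕ} (hn : 0 < n) {D : Fin n → Traj T S A₁ A₂}
    (hbd : ∀ k, (E.fit n k D).BoundedAt G πb π C Rmax)
    (hpath : ∀ i, 0 < G.pathWeight πb (D i).1) {lam : ℝ} (hlam : 0 ≤ lam)
    (hdev : ∀ k (c : Path T S A₁ A₂ × Option (Fin T)),
      |∑ i with fold n i = k, (Game.pathTerm c (D i) - ∫ x, Game.pathTerm c x ∂(G.trajLaw πb))| ≤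
        lam)
    {ε₁ ε₂ : ℝ} (hε₁ : 0 ≤ ε₁) (hε₂ : 0 ≤ ε₂)
    (hacc : ∀ k, (E.fit n k D).Accurate G πb ε₁ ε₂) :
    |E.drlValue G.γ n D π - G.value π| ≤
      1 / n * ((K * Fintype.card (Path T S A₁ A₂ × Option (Fin T)) : ℕ) *
        (coeffBound T C Rmax * lam)) +
      T * (2 * (((1 + Fintype.card S : ℝ) ^ T * ε₁) * ((1 + Fintype.card S : ℝ) ^ T * ε₂))) := by
  let c : Fin K → Path T S A₁ A₂ × Option (Fin T) → ℝ := fun k c =>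
    scoreCoeff G.γ ((E.fit n k D).densityRatio π) ((E.fit n k D).actionValue G.γ π)
      ((E.fit n k D).stateValue G.γ π) c.1 c.2
  let m : Path T S A₁ A₂ × Option (Fin T) → ℝ := fun c => ∫ x, Game.pathTerm c x ∂(G.trajLaw πb)
  have hval : E.drlValue G.γ n D π =
      1 / (n : ℝ) * ∑ i, ∑ j, c (fold n i) j * Game.pathTerm j (D i) := by
    simp only [CrossFit.drlValue, score_eq_sum_pathTerm, c]
  have hc : ∀ k j, |c k j * ∑ i with fold n i = k, (Game.pathTerm j (D i) - m j)| ≤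
      coeffBound T C Rmax * lam := by
    intro k j
    rcases (G.pathWeight_nonneg πb j.1).eq_or_lt' with h0 | hpos
    · -- A path of probability zero does not occur in the data.
      have hzero : ∀ i, Game.pathTerm j (D i) - m j = 0 := by
        intro i
        have hne : (D i).1 ≠ j.1 := fun h => (hpath i).ne' (h ▸ h0)
        simp only [m]
        rw [G.integral_pathTerm hreward, h0]
        simp [Game.pathTerm, hne]
      simp only [hzero, Finset.sum_const_zero, mul_zero, abs_zero]
      exact mul_nonneg (coeffBound_nonneg _ _ _) hlam
    · rw [abs_mul]
      exact mul_le_mul ((hbd k).abs_scoreCoeff_le hov hpos j.2) (hdev k j) (abs_nonneg _)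
        (coeffBound_nonneg _ _ _)
  have hb : ∀ k, |∑ j, c k j * m j - G.value π| ≤
      T * (2 * (((1 + Fintype.card S : ℝ) ^ T * ε₁) * ((1 + Fintype.card S : ℝ) ^ T * ε₂))) := by
    intro k
    have h := G.abs_sum_pathWeight_score_sub_le hov (E.fit n k D) hε₁ hε₂ (hacc k).reward
      (hacc k).density
    have hsum : ∑ j, c k j * m j = ∑ z, G.pathWeight πb z * score G.γ
        ((E.fit n k D).densityRatio π) ((E.fit n k D).actionValue G.γ π)
        ((E.fit n k D).stateValue G.γ π) (z, G.meanRewards z) := by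
      rw [Fintype.sum_prod_type]
      refine Finset.sum_congr rfl fun z _ => ?_
      rw [score_eq_sum, Finset.mul_sum]
      refine Finset.sum_congr rfl fun j _ => ?_
      simp only [c, m]
      rw [G.integral_pathTerm hreward]
      ring
    rw [G.value_eq_stepValue hreward, hsum]
    exact h
  rw [hval]
  exact abs_average_sub_le hn (fold n) c Game.pathTerm m D hc hb

/-- A uniform bound for the estimated values gives a bound for the estimated exploitability. -/
theorem CrossFit.abs_exploitability_sub_le (E : CrossFit T S A₁ A₂ K fold) {G : Game S A₁ A₂}
    {Rmax : ℝ} (hreward : ∀ s a₁ a₂, ∀ᵐ r ∂(G.rewardLaw s a₁ a₂ : Measure ℝ), |r| ≤ Rmax)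
    {Pi₁ : Set (Policy T S A₁)} {Pi₂ : Set (Policy T S A₂)} {πe : Profile T S A₁ A₂}
    (h₁ : πe.1 ∈ Pi₁) (h₂ : πe.2 ∈ Pi₂) {n : ℕ} {D : Fin n → Traj T S A₁ A₂} {B : ℝ}
    (h : ∀ π ∈ Pi₁ ×ˢ Pi₂, |E.drlValue G.γ n D π - G.value π| ≤ B) :
    |G.exploitability Pi₁ Pi₂ πe - E.drlExploitability G.γ Pi₁ Pi₂ πe n D| ≤ 2 * B := by
  have : Nonempty Pi₁ := ⟨⟨_, h₁⟩⟩
  have : Nonempty Pi₂ := ⟨⟨_, h₂⟩⟩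
  have e₁ : |(⨆ p : Pi₁, E.drlValue G.γ n D ((p : Policy T S A₁), πe.2)) -
      ⨆ p : Pi₁, G.value ((p : Policy T S A₁), πe.2)| ≤ B := by
    refine abs_iSup_sub_iSup_le ⟨T * Rmax, ?_⟩ fun p => h _ ⟨p.2, h₂⟩
    rintro _ ⟨p, rfl⟩
    exact (le_abs_self _).trans (G.abs_value_le hreward _)
  have e₂ : |(⨆ p : Pi₂, -E.drlValue G.γ n D (πe.1, (p : Policy T S A₂))) -
      ⨆ p : Pi₂, -G.value (πe.1, (p : Policy T S A₂))| ≤ B := by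
    refine abs_iSup_sub_iSup_le ⟨T * Rmax, ?_⟩ fun p => ?_
    · rintro _ ⟨p, rfl⟩
      exact (neg_le_abs _).trans (G.abs_value_le hreward _)
    · rw [neg_sub_neg, abs_sub_comm]
      exact h _ ⟨h₁, p.2⟩
  rw [Game.exploitability, CrossFit.drlExploitability, abs_sub_comm, add_sub_add_comm, two_mul]
  exact (abs_add_le _ _).trans (add_le_add e₁ e₂)

end GoodEvent

/-! ### Probability of the good event -/

section Probability

variable {T : ℕ} {S A₁ A₂ : Type*} [Fintype S] [Fintype A₁] [Fintype A₂]
  [MeasurableSpace S] [MeasurableSingletonClass S]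
  [MeasurableSpace A₁] [MeasurableSingletonClass A₁]
  [MeasurableSpace A₂] [MeasurableSingletonClass A₂]
  {K : ℕ} {fold : (n : ℕ) → Fin n → Fin K}

/-- The probability that some path term deviates by more than `lam` on some fold. -/
theorem measure_exists_deviation_gt_le (G : Game S A₁ A₂) (πb : Profile T S A₁ A₂) {Rmax : ℝ}
    (hreward : ∀ s a₁ a₂, ∀ᵐ r ∂(G.rewardLaw s a₁ a₂ : Measure ℝ), |r| ≤ Rmax) {n : ℕ}
    (f : Fin n → Fin K) {lam : ℝ} (hlam : 0 < lam) :
    G.dataLaw πb n {D | ∃ k, ∃ c : Path T S A₁ A₂ × Option (Fin T), lam <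
      |∑ i with f i = k, (Game.pathTerm c (D i) - ∫ x, Game.pathTerm c x ∂(G.trajLaw πb))|} ≤
    ENNReal.ofReal ((K * Fintype.card (Path T S A₁ A₂ × Option (Fin T)) : ℕ) *
      (2 * Real.exp (-lam ^ 2 / (2 * (n * max 1 Rmax ^ 2))))) := by
  set b := 2 * Real.exp (-lam ^ 2 / (2 * (n * max 1 Rmax ^ 2))) with hb
  have hb0 : 0 ≤ b := by positivity
  calc _ ≤ G.dataLaw πb n (⋃ x : Fin K × (Path T S A₁ A₂ × Option (Fin T)), {D | lam ≤
        |∑ i with f i = x.1, (Game.pathTerm x.2 (D i) -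
          ∫ y, Game.pathTerm x.2 y ∂(G.trajLaw πb))|}) := by
        refine measure_mono fun D hD => ?_
        obtain ⟨k, c, h⟩ := hD
        exact Set.mem_iUnion.2 ⟨(k, c), h.le⟩
    _ ≤ ∑ x : Fin K × (Path T S A₁ A₂ × Option (Fin T)), ENNReal.ofReal b := by
        refine (measure_iUnion_fintype_le _ _).trans (Finset.sum_le_sum fun x _ => ?_)
        exact measure_abs_sum_sub_ge_le (G.trajLaw πb) (Game.measurable_pathTerm x.2)
          (lt_of_lt_of_le one_pos (le_max_left _ _)) (G.ae_abs_pathTerm_le hreward πb x.2) _ hlam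
    _ = _ := by
        rw [Finset.sum_const, Finset.card_univ, Fintype.card_prod, Fintype.card_fin,
          ← ENNReal.ofReal_nsmul, nsmul_eq_mul]

/-- With probability tending to one, all fitted models are accurate at the rates `n ^ (-α₁)` and
`n ^ (-α₂)`. -/
theorem CrossFit.tendsto_measure_not_accurate (E : CrossFit T S A₁ A₂ K fold)
    (hmeas : E.IsMeasurable) {G : Game S A₁ A₂} {πb : Profile T S A₁ A₂} {α₁ α₂ : ℝ}
    (hrate₁ : E.RewardTransRate G πb α₁) (hrate₂ : E.TransDensityRate G πb α₂) :
    Tendsto (fun n : ℕ => G.dataLaw πb n {D | ¬ ∀ k, (E.fit n k D).Accurate G πb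
      ((n : ℝ) ^ (-α₁)) ((n : ℝ) ^ (-α₂))}) atTop (𝓝 0) := by
  let e₁ (k : Fin K) (t t' : Fin T) (z : Path T S A₁ A₂) (n : ℕ)
      (D : Fin n → Traj T S A₁ A₂) : ℝ :=
    (E.fit n k D).reward (z.1 t'.castSucc) (z.2.1 t') (z.2.2 t') *
        ∏ l ∈ Finset.Ico t t', z.step (E.fit n k D).trans l -
      G.meanReward (z.1 t'.castSucc) (z.2.1 t') (z.2.2 t') *
        ∏ l ∈ Finset.Ico t t', z.step G.transFn l
  let e₂ (k : Fin K) (t : Fin T) (z : Path T S A₁ A₂) (n : ℕ)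
      (D : Fin n → Traj T S A₁ A₂) : ℝ :=
    (E.fit n k D).init (z.1 0) * (∏ l ∈ Finset.Iio t, z.step (E.fit n k D).trans l) /
        (E.fit n k D).behav t (z.1 t.castSucc) (z.2.1 t) (z.2.2 t) -
      G.init.1 (z.1 0) * (∏ l ∈ Finset.Iio t, z.step G.transFn l) /
        G.occupancy πb t (z.1 t.castSucc) (z.2.1 t) (z.2.2 t)
  have hres : ∀ (n : ℕ) (k : Fin K), Measurable fun (D : Fin n → Traj T S A₁ A₂)
      (i : {i : Fin n // fold n i ≠ k}) => D i :=
    fun n k => measurable_pi_lambda _ fun i => measurable_pi_apply _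
  have hprod : ∀ k (z : Path T S A₁ A₂) n (I : Finset (Fin T)), Measurable fun D : Fin n → Traj T S A₁ A₂ =>
      ∏ l ∈ I, z.step (E.fit n k D).trans l := fun k z n I =>
    Finset.measurable_prod _ fun l _ => ((hmeas n k).2.1 _ _ _ _).comp (hres n k)
  have hm₁ : ∀ k t t' z n, Measurable (e₁ k t t' z n) := fun k t t' z n =>
    ((((hmeas n k).2.2.1 _ _ _).comp (hres n k)).mul (hprod k z n _)).sub_const _
  have hm₂ : ∀ k t z n, Measurable (e₂ k t z n) := fun k t z n =>
    (((((hmeas n k).1 _).comp (hres n k)).mul (hprod k z n _)).div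
      (((hmeas n k).2.2.2 _ _ _ _).comp (hres n k))).sub_const _
  let good₁ (t t' : Fin T) (z : Path T S A₁ A₂) : Prop :=
    t ≤ t' ∧ 0 < G.occupancy πb t (z.1 t.castSucc) (z.2.1 t) (z.2.2 t) ∧
    ∀ l : Fin T, t < l → l ≤ t' → 0 < πb.prob l (z.1 l.castSucc) (z.2.1 l) (z.2.2 l)
  let good₂ (t : Fin T) (z : Path T S A₁ A₂) : Prop :=
    0 < G.occupancy πb t (z.1 t.castSucc) (z.2.1 t) (z.2.2 t) ∧
    ∀ l : Fin T, l < t → 0 < πb.prob l (z.1 l.castSucc) (z.2.1 l) (z.2.2 l)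
  let B₁ (n : ℕ) (x : Fin K × Fin T × Fin T × Path T S A₁ A₂) : Set (Fin n → Traj T S A₁ A₂) :=
    {D | good₁ x.2.1 x.2.2.1 x.2.2.2 ∧ (n : ℝ) ^ (-α₁) < |e₁ x.1 x.2.1 x.2.2.1 x.2.2.2 n D|}
  let B₂ (n : ℕ) (x : Fin K × Fin T × Path T S A₁ A₂) : Set (Fin n → Traj T S A₁ A₂) :=
    {D | good₂ x.2.1 x.2.2 ∧ (n : ℝ) ^ (-α₂) < |e₂ x.1 x.2.1 x.2.2 n D|}
  have ht₁ : ∀ x, Tendsto (fun n => G.dataLaw πb n (B₁ n x)) atTop (𝓝 0) := by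
    rintro ⟨k, t, t', z⟩
    by_cases hg : good₁ t t' z
    · simp only [B₁, hg, true_and]
      exact tendsto_measure_abs_gt (G.dataLaw πb) (e₁ k t t' z) (hm₁ k t t' z) α₁
        (hrate₁ k t t' hg.1 z hg.2.1 hg.2.2)
    · simp [B₁, hg]
  have ht₂ : ∀ x, Tendsto (fun n => G.dataLaw πb n (B₂ n x)) atTop (𝓝 0) := by
    rintro ⟨k, t, z⟩
    by_cases hg : good₂ t z
    · simp only [B₂, hg, true_and]
      exact tendsto_measure_abs_gt (G.dataLaw πb) (e₂ k t z) (hm₂ k t z) α₂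
        (hrate₂ k t z hg.1 hg.2)
    · simp [B₂, hg]
  have hsum : Tendsto (fun n => ∑ x, G.dataLaw πb n (B₁ n x) + ∑ x, G.dataLaw πb n (B₂ n x))
      atTop (𝓝 0) := by
    have h := (tendsto_finsetSum Finset.univ fun x _ => ht₁ x).add
      (tendsto_finsetSum Finset.univ fun x _ => ht₂ x)
    simpa using h
  refine tendsto_of_tendsto_of_tendsto_of_le_of_le tendsto_const_nhds hsum
    (fun _ => zero_le) fun n => ?_
  calc _ ≤ G.dataLaw πb n ((⋃ x, B₁ n x) ∪ ⋃ x, B₂ n x) := by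
        refine measure_mono fun D hD => ?_
        by_contra hnot
        simp only [Set.mem_union, Set.mem_iUnion, not_or, not_exists] at hnot
        refine hD fun k => ⟨fun t t' htt z h1 h2 => ?_, fun t z h1 h2 => ?_⟩
        · exact not_lt.1 fun h => hnot.1 (k, t, t', z) ⟨⟨htt, h1, h2⟩, h⟩
        · exact not_lt.1 fun h => hnot.2 (k, t, z) ⟨⟨h1, h2⟩, h⟩
    _ ≤ _ := (measure_union_le _ _).trans
        (add_le_add (measure_iUnion_fintype_le _ _) (measure_iUnion_fintype_le _ _))

end Probability

end TZMG

/-! ### The error of the estimated exploitability -/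

theorem theorem5 (T : ℕ) (S A₁ A₂ : Type*) [Fintype S] [Fintype A₁] [Fintype A₂]
    [MeasurableSpace S] [MeasurableSingletonClass S]
    [MeasurableSpace A₁] [MeasurableSingletonClass A₁]
    [MeasurableSpace A₂] [MeasurableSingletonClass A₂]
    (G : TZMG.Game S A₁ A₂) (πb πe : TZMG.Profile T S A₁ A₂)
    (Pi₁ : Set (TZMG.Policy T S A₁)) (Pi₂ : Set (TZMG.Policy T S A₂))
    (hπe₁ : πe.1 ∈ Pi₁) (hπe₂ : πe.2 ∈ Pi₂)
    -- overlap and bounded rewards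
    (C₀ Rmax : ℝ)
    (hoverlap : ∀ π ∈ Pi₁ ×ˢ Pi₂, ∀ (t : Fin T) (s : S) (a₁ : A₁) (a₂ : A₂),
      TZMG.Profile.prob π t s a₁ a₂ ≤ C₀ * TZMG.Profile.prob πb t s a₁ a₂)
    (hreward : ∀ s a₁ a₂, ∀ᵐ r ∂(G.rewardLaw s a₁ a₂ : MeasureTheory.Measure ℝ), |r| ≤ Rmax)
    -- evenly sized folds and cross-fitted model estimates
    (K : ℕ) (hK : 0 < K) (fold : (n : ℕ) → Fin n → Fin K)
    (hfold : ∀ (n : ℕ) (k : Fin K), n / K ≤ Nat.card {i : Fin n // fold n i = k} ∧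
      Nat.card {i : Fin n // fold n i = k} ≤ n / K + 1)
    (E : TZMG.CrossFit T S A₁ A₂ K fold) (hmeas : E.IsMeasurable)
    (hbounded : E.Bounded G πb (Pi₁ ×ˢ Pi₂) C₀ Rmax)
    -- covering numbers
    (D₁ D₂ ω : ℝ) (hD₁ : 0 < D₁) (hD₂ : 0 < D₂) (hω₀ : 0 ≤ ω) (hω₁ : ω < 1 / 2)
    (hcover : ∀ ε : ℝ, 0 < ε → ε < 1 →
      ((TZMG.coveringNumber (Pi₁ ×ˢ Pi₂) ε : ℕ∞) : ENNReal) ≤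
        ENNReal.ofReal (D₁ * Real.exp (D₂ * (1 / ε) ^ ω)))
    -- convergence rates of the estimated model
    (α₁ α₂ : ℝ) (hα₁ : 0 < α₁) (hα₂ : 0 < α₂) (hα : 1 / 2 ≤ α₁ + α₂)
    (hrate₁ : E.RewardTransRate G πb α₁)
    (hrate₂ : E.TransDensityRate G πb α₂)
    -- nondegeneracy
    (hΥ : 0 < G.upsilonStar πb (Pi₁ ×ˢ Pi₂)) :
    ∃ C : ℝ, 0 < C ∧ ∀ δ : ℝ, 0 < δ → ∃ N : ℕ, 0 < N ∧ ∀ n : ℕ, N ≤ n →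
      ENNReal.ofReal (1 - 2 * δ) ≤
        G.dataLaw πb n {D | |G.exploitability Pi₁ Pi₂ πe -
              E.drlExploitability G.γ Pi₁ Pi₂ πe n D| ≤
            C * (TZMG.entropyIntegral (Pi₁ ×ˢ Pi₂) + Real.sqrt (Real.log (1 / δ))) *
              Real.sqrt (G.upsilonStar πb (Pi₁ ×ˢ Pi₂) / n)} := by
  have hov : ∀ π ∈ Pi₁ ×ˢ Pi₂, ∀ t s a b,
      0 < TZMG.Profile.prob π t s a b → 0 < TZMG.Profile.prob πb t s a b := by
    intro π hπ t s a b hpos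
    have ht : t < T := by
      by_contra ht
      simp [TZMG.Profile.prob, ht] at hpos
    refine lt_of_le_of_ne (TZMG.Profile.prob_nonneg _ _ _ _ _) fun h0 => ?_
    have h := hoverlap π hπ ⟨t, ht⟩ s a b
    rw [← h0, mul_zero] at h
    exact absurd hpos (not_lt.2 h)
  set A : ℝ := ((K * Fintype.card (TZMG.Path T S A₁ A₂ × Option (Fin T)) : ℕ) : ℝ)
  set Cc := TZMG.coeffBound T C₀ Rmax
  set B : ℝ := max 1 Rmax
  set W : ℝ := (1 + Fintype.card S : ℝ) ^ T
  set Υ := G.upsilonStar πb (Pi₁ ×ˢ Pi₂)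
  have hA0 : 0 ≤ A := Nat.cast_nonneg _
  have hCc0 : 0 ≤ Cc := TZMG.coeffBound_nonneg _ _ _
  have hB0 : 0 < B := lt_of_lt_of_le one_pos (le_max_left _ _)
  have hW0 : 0 ≤ W := by positivity
  have hlog2 : 0 < Real.log 2 := Real.log_pos one_lt_two
  have hκ : 0 ≤ TZMG.entropyIntegral (Pi₁ ×ˢ Pi₂) :=
    integral_nonneg fun _ => Real.sqrt_nonneg _
  have hlogA : 0 ≤ Real.log (2 * (A + 1)) := Real.log_nonneg (by linarith)
  -- As `δ < 1/2` in the nontrivial case, `log (1/δ)` is at least `log 2` and absorbs constants.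
  set cL : ℝ := Real.sqrt (2 * (Real.log (2 * (A + 1)) / Real.log 2 + 1)) with hcL
  set C' : ℝ := 2 * (A * Cc * B * cL + 2 * T * W ^ 2 / Real.sqrt (Real.log 2)) with hC'
  have hC'0 : 0 ≤ C' := by positivity
  refine ⟨C' / Real.sqrt Υ + 1, by positivity, fun δ hδ => ?_⟩
  rcases le_or_gt (1 / 2) δ with hδ2 | hδ2
  · refine ⟨1, one_pos, fun n _ => ?_⟩
    rw [ENNReal.ofReal_of_nonpos (by linarith)]
    exact zero_le
  have hδ' : ENNReal.ofReal δ ≠ 0 := by simpa using hδ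
  obtain ⟨N, hN⟩ := eventually_atTop.1 ((E.tendsto_measure_not_accurate hmeas hrate₁
    hrate₂).eventually_le_const (pos_iff_ne_zero.2 hδ'))
  refine ⟨max N 1, by positivity, fun n hn => ?_⟩
  have hn1 : 1 ≤ n := (le_max_right _ _).trans hn
  have hn0 : 0 < n := hn1
  have hnR : (0 : ℝ) < n := Nat.cast_pos.2 hn0
  set ℓ := Real.log (1 / δ) with hℓ
  have hℓ2 : Real.log 2 ≤ ℓ := Real.log_le_log two_pos (by rw [le_div_iff₀ hδ]; linarith)
  have hℓ0 : 0 < ℓ := hlog2.trans_le hℓ2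
  -- The deviation level at which Hoeffding's inequality and a union bound give probability `δ`.
  set L : ℝ := Real.sqrt (2 * Real.log (2 * (A + 1) / δ)) with hL
  have hlogpos : 0 < Real.log (2 * (A + 1) / δ) :=
    Real.log_pos (by rw [one_lt_div hδ]; linarith)
  have hL0 : 0 < L := Real.sqrt_pos.2 (by linarith)
  have hLle : L ≤ cL * Real.sqrt ℓ := by
    rw [hL, hcL, ← Real.sqrt_mul (by positivity)]
    refine Real.sqrt_le_sqrt ?_
    have h1 : Real.log (2 * (A + 1) / δ) = Real.log (2 * (A + 1)) + ℓ := by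
      rw [hℓ, ← Real.log_mul (by positivity) (by positivity), mul_one_div]
    have h2 : Real.log (2 * (A + 1)) ≤ Real.log (2 * (A + 1)) / Real.log 2 * ℓ := by
      rw [div_mul_eq_mul_div, le_div_iff₀ hlog2]
      exact mul_le_mul_of_nonneg_left hℓ2 hlogA
    rw [h1]
    nlinarith
  set lam : ℝ := Real.sqrt n * (B * L) with hlamdef
  have hlam : 0 < lam := by positivity
  have hdevP := TZMG.measure_exists_deviation_gt_le G πb hreward (fold n) hlam
  have hdevδ : A * (2 * Real.exp (-lam ^ 2 / (2 * (n * B ^ 2)))) ≤ δ := by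
    have h1 : -lam ^ 2 / (2 * (n * B ^ 2)) = -Real.log (2 * (A + 1) / δ) := by
      rw [hlamdef, mul_pow, mul_pow, Real.sq_sqrt hnR.le, hL, Real.sq_sqrt (by linarith)]
      field_simp
    rw [h1, Real.exp_neg, Real.exp_log (by positivity), inv_div]
    calc A * (2 * (δ / (2 * (A + 1)))) = A / (A + 1) * δ := by field_simp
      _ ≤ 1 * δ := mul_le_mul_of_nonneg_right
          ((div_le_one (by linarith)).2 (by linarith)) hδ.le
      _ = δ := one_mul δ
  have hbd := ae_all_iff.2 fun k : Fin K => hbounded n k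
  have hpath := G.ae_dataLaw_pathWeight_pos πb n
  set good : Set (Fin n → TZMG.Traj T S A₁ A₂) := {D | |G.exploitability Pi₁ Pi₂ πe -
      E.drlExploitability G.γ Pi₁ Pi₂ πe n D| ≤
        (C' / Real.sqrt Υ + 1) * (TZMG.entropyIntegral (Pi₁ ×ˢ Pi₂) + Real.sqrt ℓ) *
          Real.sqrt (Υ / n)}
  set bad₁ : Set (Fin n → TZMG.Traj T S A₁ A₂) := {D | ∃ k,
    ∃ c : TZMG.Path T S A₁ A₂ × Option (Fin T), lam < |∑ i with fold n i = k,
      (TZMG.Game.pathTerm c (D i) - ∫ x, TZMG.Game.pathTerm c x ∂(G.trajLaw πb))|}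
  set bad₂ : Set (Fin n → TZMG.Traj T S A₁ A₂) := {D | ¬ ∀ k, (E.fit n k D).Accurate G πb
    ((n : ℝ) ^ (-α₁)) ((n : ℝ) ^ (-α₂))}
  have hrate : (n : ℝ) ^ (-α₁) * (n : ℝ) ^ (-α₂) ≤ 1 / Real.sqrt n := by
    rw [← Real.rpow_add hnR, Real.sqrt_eq_rpow, one_div, ← Real.rpow_neg hnR.le]
    exact Real.rpow_le_rpow_of_exponent_le (by exact_mod_cast hn1) (by linarith)
  have hincl : ∀ᵐ D ∂(G.dataLaw πb n), D ∈ goodᶜ → D ∈ bad₁ ∪ bad₂ := by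
    filter_upwards [hbd, hpath] with D hD hDpath hDbad
    by_contra hnot
    rw [Set.mem_union, not_or] at hnot
    obtain ⟨h1, h2⟩ := hnot
    have h1' : ∀ k (c : TZMG.Path T S A₁ A₂ × Option (Fin T)), |∑ i with fold n i = k,
        (TZMG.Game.pathTerm c (D i) - ∫ x, TZMG.Game.pathTerm c x ∂(G.trajLaw πb))| ≤ lam :=
      fun k c => not_lt.1 fun h => h1 ⟨k, c, h⟩
    have h2' : ∀ k, (E.fit n k D).Accurate G πb ((n : ℝ) ^ (-α₁)) ((n : ℝ) ^ (-α₂)) :=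
      not_not.1 h2
    refine hDbad ?_
    have hval := E.abs_exploitability_sub_le hreward hπe₁ hπe₂ fun π hπ =>
      E.abs_drlValue_sub_value_le (hov π hπ) hreward hn0 (fun k => hD k π hπ) hDpath hlam.le h1'
        (Real.rpow_nonneg hnR.le _) (Real.rpow_nonneg hnR.le _) h2'
    refine hval.trans ?_
    have hsqn : 0 < Real.sqrt n := Real.sqrt_pos.2 hnR
    have hsqℓ : 0 < Real.sqrt ℓ := Real.sqrt_pos.2 hℓ0
    have hsql2 : 0 < Real.sqrt (Real.log 2) := Real.sqrt_pos.2 hlog2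
    have hpart1 : 1 / (n : ℝ) * (A * (Cc * lam)) ≤
        A * Cc * B * cL * Real.sqrt ℓ / Real.sqrt n := by
      have e : 1 / (n : ℝ) * (A * (Cc * lam)) = A * Cc * B * L / Real.sqrt n := by
        have hsq : 1 / (n : ℝ) * Real.sqrt n = 1 / Real.sqrt n := by
          rw [one_div_mul_eq_div, Real.sqrt_div_self']
        calc 1 / (n : ℝ) * (A * (Cc * lam)) =
            A * Cc * B * L * (1 / (n : ℝ) * Real.sqrt n) := by rw [hlamdef]; ring
          _ = A * Cc * B * L / Real.sqrt n := by rw [hsq]; ring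
      rw [e, mul_assoc _ cL]
      gcongr
    have hpart2 : T * (2 * ((W * (n : ℝ) ^ (-α₁)) * (W * (n : ℝ) ^ (-α₂)))) ≤
        2 * T * W ^ 2 / Real.sqrt (Real.log 2) * Real.sqrt ℓ / Real.sqrt n := by
      have e : T * (2 * ((W * (n : ℝ) ^ (-α₁)) * (W * (n : ℝ) ^ (-α₂)))) =
          2 * T * W ^ 2 * ((n : ℝ) ^ (-α₁) * (n : ℝ) ^ (-α₂)) := by ring
      rw [e]
      have hone : 1 / Real.sqrt n ≤
          Real.sqrt ℓ / Real.sqrt (Real.log 2) / Real.sqrt n := by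
        gcongr
        rw [one_le_div hsql2]
        exact Real.sqrt_le_sqrt hℓ2
      calc 2 * T * W ^ 2 * ((n : ℝ) ^ (-α₁) * (n : ℝ) ^ (-α₂))
          ≤ 2 * T * W ^ 2 * (Real.sqrt ℓ / Real.sqrt (Real.log 2) / Real.sqrt n) :=
            mul_le_mul_of_nonneg_left (hrate.trans hone) (by positivity)
        _ = _ := by ring
    have hsqΥ : 0 < Real.sqrt Υ := Real.sqrt_pos.2 hΥ
    calc _ ≤ 2 * (A * Cc * B * cL * Real.sqrt ℓ / Real.sqrt n +
          2 * T * W ^ 2 / Real.sqrt (Real.log 2) * Real.sqrt ℓ / Real.sqrt n) :=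
          mul_le_mul_of_nonneg_left (add_le_add hpart1 hpart2) two_pos.le
      _ = C' / Real.sqrt Υ * Real.sqrt ℓ * (Real.sqrt Υ / Real.sqrt n) := by
          rw [hC']; field_simp
      _ ≤ (C' / Real.sqrt Υ + 1) * (TZMG.entropyIntegral (Pi₁ ×ˢ Pi₂) + Real.sqrt ℓ) *
          (Real.sqrt Υ / Real.sqrt n) := by
          gcongr
          · linarith
          · linarith
      _ = _ := by rw [Real.sqrt_div hΥ.le]
  have hcompl : G.dataLaw πb n goodᶜ ≤ ENNReal.ofReal (2 * δ) :=
    calc G.dataLaw πb n goodᶜ ≤ G.dataLaw πb n (bad₁ ∪ bad₂) := measure_mono_ae hincl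
      _ ≤ G.dataLaw πb n bad₁ + G.dataLaw πb n bad₂ := measure_union_le _ _
      _ ≤ ENNReal.ofReal δ + ENNReal.ofReal δ :=
          add_le_add (hdevP.trans (ENNReal.ofReal_le_ofReal hdevδ))
            (hN n ((le_max_left _ _).trans hn))
      _ = ENNReal.ofReal (2 * δ) := by rw [← ENNReal.ofReal_add hδ.le hδ.le, two_mul]
  -- Subadditivity suffices here: measurability of the event is not needed.
  have hone : (1 : ENNReal) ≤ G.dataLaw πb n good + G.dataLaw πb n goodᶜ := by
    rw [← measure_univ (μ := G.dataLaw πb n), ← Set.union_compl_self good]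
    exact measure_union_le _ _
  calc ENNReal.ofReal (1 - 2 * δ) = 1 - ENNReal.ofReal (2 * δ) := by
        rw [ENNReal.ofReal_sub _ (by linarith), ENNReal.ofReal_one]
    _ ≤ G.dataLaw πb n good := tsub_le_iff_right.2 (hone.trans (add_le_add le_rfl hcompl))
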